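/- Let $\Gamma$ be an infinite, locally finite tree with root $\overline 0$, and let $|x-\overline 0|$ be the graph distance. Each vertex $x$ carries a spin $\deg(x)/2$, i.e. the Hilbert space $\mathbb C^{\deg(x)+1}$. For $n\ge 0$ let $T_n$ be the set of vertices with $|x-\overline 0|\le n$ and $\partial T_n$ the set of vertices with $|x-\overline 0|=n+1$. The AKLT Hamiltonian of $T_n$ is $H_n=\sum_{(x,y)}P_{xy}$, summed over the edges with both endpoints in $T_n$, where $P_{xy}$ is the orthogonal projection onto the states in which $x$ and $y$ have the maximal total spin $(\deg(x)+\deg(y))/2$. View the spin at $x$ as the symmetric subspace of $\deg(x)$ spins $\tfrac12$, one for each edge at $x$. Let $\Psi_n:(\mathbb C^2)^{\otimes \partial T_n}\to\bigotimes_{x\in T_n}\mathbb C^{\deg(x)+1}$ be the valence bond solid map: it puts a singlet on each edge inside $T_n$, puts the boundary spins $\tfrac12$ on the edges from $T_n$ to $\partial T_n$, and projects at each vertex onto the symmetric subspace. A boundary condition on $T_n$ is a positive semidefinite $B_n\in M_2(\mathbb C)^{\otimes \partial T_n}$ with $\operatorname{Tr}(\Psi_nB_n\Psi_n^*)\ne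 0$ and $H_n\Psi_nB_n\Psi_n^*=0$ (the last condition says that the state below is a ground state of $H_n$). It defines the finite-volume ground state $$\omega^n_{B_n}(A)=\frac{\operatorname{Tr}(\Psi_nB_n\Psi_n^*\,A)}{\operatorname{Tr}(\Psi_nB_n\Psi_n^*)}$$ on the observables $A$ supported in $T_n$. An infinite-volume ground state is a functional $\omega$ on the local observables (those supported in a finite set of vertices) such that, for some sequence $(B_n)$ of boundary conditions, $\omega(A)=\lim_{n\to\infty}\omega^n_{B_n}(A)$ for every local observable $A$. **Theorem.** Suppose that there are integers $d_i$ such that $\deg(x)=d_i$ for every vertex $x$ with $|x-\overline 0|=i$, and that the limit $$\lim_{n\to\infty}\frac1n\sum_{i=1}^n\ln\frac{d_i-1}{3}$$ exists in $[-\infty,+\infty]$ and is $>0$. Then the AKLT ground state on $\Gamma$ is not unique: there are two different infinite-volume ground states. -/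

import Mathlib

open Filter Topology
open scoped ComplexOrder

noncomputable section

namespace AKLT

/-! ### Spin matrices

The spin-`d/2` space is `ℂ^(d+1)` with orthonormal basis `|0⟩, …, |d⟩`, where `|k⟩` is the
normalised symmetric state of `d` spins 1/2 of which `k` are up; it has `S^z`-eigenvalue
`k - d/2`. -/

/-- `S^z` in the spin-`d/2` representation. -/
def spinZ (d : ℕ) : Matrix (Fin (d + 1)) (Fin (d + 1)) ℂ :=
  Matrix.diagonal fun k => ((k : ℕ) : ℂ) - (d : ℂ) / 2

/-- `S^+` in the spin-`d/2` representation: `S^+ |l⟩ = √((d - l)(l + 1)) |l + 1⟩`. -/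
def spinPlus (d : ℕ) : Matrix (Fin (d + 1)) (Fin (d + 1)) ℂ :=
  Matrix.of fun k l =>
    if (k : ℕ) = (l : ℕ) + 1 then
      ((Real.sqrt (((d : ℝ) - ((l : ℕ) : ℝ)) * (((l : ℕ) : ℝ) + 1)) : ℝ) : ℂ)
    else 0

/-- `S^- = (S^+)^*`. -/
def spinMinus (d : ℕ) : Matrix (Fin (d + 1)) (Fin (d + 1)) ℂ := (spinPlus d).conjTranspose

/-- `S^x = (S^+ + S^-) / 2`. -/
def spinX (d : ℕ) : Matrix (Fin (d + 1)) (Fin (d + 1)) ℂ :=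
  (1 / 2 : ℂ) • (spinPlus d + spinMinus d)

/-- `S^y = (S^+ - S^-) / (2i)`. -/
def spinY (d : ℕ) : Matrix (Fin (d + 1)) (Fin (d + 1)) ℂ :=
  (1 / (2 * Complex.I) : ℂ) • (spinPlus d - spinMinus d)

section Graph

variable {V : Type*} [DecidableEq V] (G : SimpleGraph V) [G.LocallyFinite]

/-! ### Hilbert spaces and observables of finite regions -/

/-- Labels of the product basis of `⨂_{x ∈ S} ℂ^(deg x + 1)`: each vertex `x` carries a spin
`deg x / 2`. -/
abbrev Config (S : Finset V) : Type _ := (x : S) → Fin (G.degree (x : V) + 1)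

/-- The observables supported in the finite region `S`: operators on
`⨂_{x ∈ S} ℂ^(deg x + 1)`, as matrices in the product basis. -/
abbrev Observable (S : Finset V) : Type _ := Matrix (Config G S) (Config G S) ℂ

/-- The one-site operator `M` at `x`, tensored with the identity at all other sites of `S`. -/
def siteOp {S : Finset V} (x : S)
    (M : Matrix (Fin (G.degree (x : V) + 1)) (Fin (G.degree (x : V) + 1)) ℂ) :
    Observable G S :=
  Matrix.of fun k l => if ∀ y : S, y ≠ x → k y = l y then M (k x) (l x) else 0

/-- The restriction of a configuration to a smaller region. -/
def restrict {S T : Finset V} (h : S ⊆ T) (k : Config G T) : Config G S :=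
  fun x => k ⟨(x : V), h x.2⟩

/-- The inclusion `A ↦ A ⊗ 1` of the observables of `S` into those of `T ⊇ S`. -/
def extend {S T : Finset V} (h : S ⊆ T) (A : Observable G S) : Observable G T :=
  Matrix.of fun k l =>
    if ∀ y : T, (y : V) ∉ S → k y = l y then A (restrict G h k) (restrict G h l) else 0

/-! ### The AKLT interaction -/

/-- `(S_x + S_y)^2`, the square of the total spin of the sites `x` and `y`. -/
def totalSpinSq {S : Finset V} (x y : S) : Observable G S :=
  (siteOp G x (spinX (G.degree (x : V))) + siteOp G y (spinX (G.degree (y : V)))) ^ 2 +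
  (siteOp G x (spinY (G.degree (x : V))) + siteOp G y (spinY (G.degree (y : V)))) ^ 2 +
  (siteOp G x (spinZ (G.degree (x : V))) + siteOp G y (spinZ (G.degree (y : V)))) ^ 2

/-- The maximal total spin `J = (deg x + deg y) / 2` of two sites. -/
def maxSpin (x y : V) : ℂ := ((G.degree x : ℂ) + (G.degree y : ℂ)) / 2

/-- The orthogonal projection onto the states in which the sites `x` and `y` have maximal total
spin `J`, that is, onto the eigenspace of `(S_x + S_y)^2` for the eigenvalue `J (J + 1)`. -/
def edgeProjection {S : Finset V} (x y : S) :
    EuclideanSpace ℂ (Config G S) →ₗ[ℂ] EuclideanSpace ℂ (Config G S) :=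
  ((Module.End.eigenspace (Matrix.toEuclideanLin (totalSpinSq G x y))
    (maxSpin G x y * (maxSpin G x y + 1))).starProjection).toLinearMap

/-! ### The finite trees `T_n` -/

variable (o : V)

/-- The vertices of `T_n`: those reachable from the root `o` in at most `n` steps. -/
def ball : ℕ → Finset V
  | 0 => {o}
  | n + 1 => ball n ∪ (ball n).biUnion fun x => G.neighborFinset x

/-- In a connected graph `ball n` is the ball of radius `n` for the graph distance. -/
theorem mem_ball (hG : G.Connected) (n : ℕ) (v : V) : v ∈ ball G o n ↔ G.dist o v ≤ n := by
  induction n generalizing v with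
  | zero => simp [ball, hG.dist_eq_zero_iff, eq_comm]
  | succ n ih =>
    simp only [ball, Finset.mem_union, Finset.mem_biUnion, SimpleGraph.mem_neighborFinset, ih]
    constructor
    · rintro (h | ⟨x, hx, hxv⟩)
      · omega
      · have h1 := hG.dist_triangle (u := o) (v := x) (w := v)
        have h2 : G.dist x v = 1 := SimpleGraph.dist_eq_one_iff_adj.mpr hxv
        omega
    · intro h
      by_cases h' : G.dist o v ≤ n
      · exact Or.inl h'
      · right
        obtain ⟨p, hp⟩ := hG.exists_walk_length_eq_dist v o
        cases p with
        | nil => simp at h'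
        | cons hadj q =>
          rename_i w
          refine ⟨w, ?_, hadj.symm⟩
          have h1 := SimpleGraph.dist_le q
          rw [SimpleGraph.Walk.length_cons, SimpleGraph.dist_comm] at hp
          rw [SimpleGraph.dist_comm]
          omega

/-- `∂T_n`: the vertices of the layer `n + 1`. -/
def boundary (n : ℕ) : Finset V := ball G o (n + 1) \ ball G o n

/-- Membership in `∂T_n` in terms of the graph distance. -/
theorem mem_boundary (hG : G.Connected) (n : ℕ) (v : V) :
    v ∈ boundary G o n ↔ G.dist o v = n + 1 := by
  rw [boundary, Finset.mem_sdiff, mem_ball G o hG, mem_ball G o hG]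
  omega

/-- `y` is a child of `x`. In a tree, each edge joins exactly one vertex to one of its
children. -/
def IsChild (x y : V) : Prop := G.Adj x y ∧ G.dist o y = G.dist o x + 1

open scoped Classical in
/-- The AKLT Hamiltonian of `T_n`: the sum of the projections onto maximal total spin over the
edges with both endpoints in `T_n`. -/
def hamiltonian (n : ℕ) :
    EuclideanSpace ℂ (Config G (ball G o n)) →ₗ[ℂ] EuclideanSpace ℂ (Config G (ball G o n)) :=
  ∑ x : ball G o n, ∑ y : ball G o n,
    if IsChild G o (x : V) (y : V) then edgeProjection G x y else 0

/-! ### Finite-volume states with boundary conditions -/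

/-- Labels of the product basis of `(ℂ²)^{⊗ ∂T_n}`; `true` is spin up. -/
abbrev BoundaryConfig (n : ℕ) : Type _ := boundary G o n → Bool

/-- Boundary conditions on `T_n`: elements of `M_2(ℂ)^{⊗ ∂T_n}`. -/
abbrev BoundaryMatrix (n : ℕ) : Type _ := Matrix (BoundaryConfig G o n) (BoundaryConfig G o n) ℂ

end Graph

/-- The amplitudes of the singlet `|↑↓⟩ - |↓↑⟩`. -/
def singlet : Bool → Bool → ℂ
  | true, false => 1
  | false, true => -1
  | _, _ => 0

/-- The overlap of the basis vector `|k⟩` of the spin-`d/2` space, that is, of the normalised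
symmetric state of `d = |ι|` spins 1/2 with `k` ups, with the product state labelled by `s`. -/
def symAmplitude {ι : Type*} [Fintype ι] (k : ℕ) (s : ι → Bool) : ℂ :=
  if (Finset.univ.filter fun i => s i = true).card = k then
    ((1 / Real.sqrt ((Fintype.card ι).choose k) : ℝ) : ℂ)
  else 0

section Graph

variable {V : Type*} [DecidableEq V] (G : SimpleGraph V) [G.LocallyFinite] (o : V)

open scoped Classical in
/-- The valence bond solid map `(ℂ²)^{⊗ ∂T_n} → ⨂_{x ∈ T_n} ℂ^(deg x + 1)`, as a matrix. Each
vertex `x` of `T_n` is composed of one spin 1/2 for each edge at `x` (`s x y` is the one for the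
edge `xy`). The two spins 1/2 of an edge inside `T_n` form a singlet, the spin 1/2 of an edge
leading to a vertex `v` of `∂T_n` is the boundary spin of `v`, and the spins 1/2 at each vertex are
projected onto their symmetric subspace. -/
def vbs (n : ℕ) : Matrix (Config G (ball G o n)) (BoundaryConfig G o n) ℂ :=
  Matrix.of fun k b =>
    ∑ s : (x : ball G o n) → G.neighborSet (x : V) → Bool,
      (∏ x : ball G o n, symAmplitude (k x : ℕ) (s x)) *
      (∏ x : ball G o n, ∏ y : ball G o n,
        if h : IsChild G o (x : V) (y : V) then
          singlet (s x ⟨(y : V), h.1⟩) (s y ⟨(x : V), h.1.symm⟩)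
        else 1) *
      (if ∀ (x : ball G o n) (v : boundary G o n) (h : G.Adj (x : V) (v : V)),
          s x ⟨(v : V), h⟩ = b v then 1 else 0)

/-- The unnormalised density matrix `Ψ_n B Ψ_n^*` on `T_n` with boundary condition `B`; for
`B = |φ⟩⟨φ|` it is the pure state of the vector `Ψ_n φ`. -/
def density (n : ℕ) (B : BoundaryMatrix G o n) : Observable G (ball G o n) :=
  vbs G o n * B * (vbs G o n).conjTranspose

/-- The expectation `ω^n_B(A)` of an observable `A` supported in `S ⊆ T_n` in the finite-volume
state on `T_n` with boundary condition `B` (set to `0` for the finitely many `n` for which `T_n`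
does not contain `S`). -/
def expectation (n : ℕ) (B : BoundaryMatrix G o n) (S : Finset V) (A : Observable G S) : ℂ :=
  if h : S ⊆ ball G o n then
    (density G o n B * extend G h A).trace / (density G o n B).trace
  else 0

/-- `B` defines a ground state of `T_n`: it is positive, the state is normalisable, and the
Hamiltonian of `T_n` annihilates it. -/
structure IsGroundBoundary (n : ℕ) (B : BoundaryMatrix G o n) : Prop where
  posSemidef : B.PosSemidef
  trace_ne_zero : (density G o n B).trace ≠ 0
  ground : hamiltonian G o n ∘ₗ Matrix.toEuclideanLin (density G o n B) = 0

/-- `ω` is an infinite-volume ground state: the weak limit, on all local observables, of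
finite-volume ground states on `T_n` with some sequence of boundary conditions `B_n`. -/
def IsInfiniteVolumeGroundState (ω : (S : Finset V) → Observable G S → ℂ) : Prop :=
  ∃ B : (n : ℕ) → BoundaryMatrix G o n,
    (∀ n, IsGroundBoundary G o n (B n)) ∧
    ∀ (S : Finset V) (A : Observable G S),
      Tendsto (fun n => expectation G o n (B n) S A) atTop (𝓝 (ω S A))

end Graph

end AKLT

end

/-!
Give each boundary spin of `T_n` the diagonal weights `e^θ` (up) and `e^{-θ}` (down). Tracing out a
leaf whose `q` outer legs carry the field `θ` leaves, up to a scalar, the field `-branchField q θ`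
on its parent leg, the sign being due to the singlet on the edge. So the states of successive balls
agree on local observables as soon as the fields `θ 1, θ 2, …` on the layers satisfy this recursion.

The map `branchField q` is odd and bounded, with slope `q / 3` at `0`. If the mean of
`log ((d i - 1) / 3)` is asymptotically positive, then a backward orbit started in a far layer at a
small field whose distance to `0` is bounded below by the product of the slopes does not die out on
its way to the root, and compactness produces an infinite orbit `θ` with `θ 1 ≠ 0`. The fields `θ`
and `-θ` then give two ground states that differ at the root.
-/

noncomputable section

namespace AKLT

/-! ### Backward orbits of a sequence of maps -/

theorem exists_backward_orbit_of_isCompact {X : ℕ → Type*} [∀ i, TopologicalSpace (X i)]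
    [∀ i, T2Space (X i)] {f : ∀ i, X (i + 1) → X i} (hf : ∀ i, Continuous (f i))
    {C : Set (∀ i, X i)} (hC : IsCompact C)
    (h : ∀ n, ∃ τ ∈ C, ∀ i < n, τ i = f i (τ (i + 1))) :
    ∃ τ ∈ C, ∀ i, τ i = f i (τ (i + 1)) := by
  obtain ⟨τ, hτC, hτ⟩ := hC.inter_iInter_nonempty (fun i => {τ | τ i = f i (τ (i + 1))})
    (fun i => isClosed_eq (continuous_apply i) ((hf i).comp (continuous_apply (i + 1))))
    fun u => by
      obtain ⟨τ, hτC, hτ⟩ := h (u.sup id + 1)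
      exact ⟨τ, hτC, Set.mem_iInter₂.mpr fun i hi =>
        hτ i (Nat.lt_succ_of_le (Finset.le_sup (f := id) hi))⟩
  exact ⟨τ, hτC, Set.mem_iInter.mp hτ⟩

theorem exists_orbit_segment {ε : ℝ} (hε : 0 < ε) {f : ℕ → ℝ → ℝ} {a M : ℕ → ℝ}
    (ha : ∀ i, 0 < a i) (hf : ∀ i x, 0 ≤ x → min (a i * x) ε ≤ f i x) (hM : ∀ i x, f i x ≤ M i)
    (n : ℕ) :
    ∃ τ : ℕ → ℝ, (∀ i, τ i ∈ Set.Icc 0 (M i)) ∧ (∀ i < n, τ i = f i (τ (i + 1))) ∧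
      ∃ m, ε * ∏ i ∈ Finset.range m, a i ≤ τ 0 := by
  induction n generalizing f a M with
  | zero =>
    refine ⟨fun _ => ε, fun i => ⟨hε.le, ?_⟩, fun i hi => absurd hi i.not_lt_zero, 0, by simp⟩
    have h := (hf i (ε / a i) (div_pos hε (ha i)).le).trans (hM i _)
    rwa [mul_div_cancel₀ _ (ha i).ne', min_self] at h
  | succ n ih =>
    obtain ⟨τ, hmem, horbit, m, hm⟩ :=
      ih (fun i => ha (i + 1)) (fun i => hf (i + 1)) fun i => hM (i + 1)
    have h0 : min (a 0 * τ 0) ε ≤ f 0 (τ 0) := hf 0 _ (hmem 0).1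
    refine ⟨fun i => i.casesOn (f 0 (τ 0)) τ, fun i => ?_, fun i hi => ?_, ?_⟩
    · cases i with
      | zero => exact ⟨(le_min (mul_nonneg (ha 0).le (hmem 0).1) hε.le).trans h0, hM 0 _⟩
      | succ i => exact hmem i
    · cases i with
      | zero => rfl
      | succ i => exact horbit i (Nat.lt_of_succ_lt_succ hi)
    · rcases min_le_iff.mp h0 with h | h
      · refine ⟨m + 1, le_trans ?_ h⟩
        rw [Finset.prod_range_succ', ← mul_assoc, mul_comm]
        exact mul_le_mul_of_nonneg_left hm (ha 0).le
      · exact ⟨0, by simpa using h⟩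

theorem exists_pos_backward_orbit {ε p : ℝ} (hε : 0 < ε) (hp : 0 < p) {f : ℕ → ℝ → ℝ}
    {a M : ℕ → ℝ} (hcont : ∀ i, Continuous (f i)) (ha : ∀ i, 0 < a i)
    (hf : ∀ i x, 0 ≤ x → min (a i * x) ε ≤ f i x) (hM : ∀ i x, f i x ≤ M i)
    (hprod : ∀ n, p ≤ ∏ i ∈ Finset.range n, a i) :
    ∃ τ : ℕ → ℝ, 0 < τ 0 ∧ ∀ i, τ i = f i (τ (i + 1)) := by
  have hcompact : IsCompact ((Set.univ.pi fun i => Set.Icc 0 (M i)) ∩ {τ | ε * p ≤ τ 0}) :=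
    (isCompact_univ_pi fun _ => isCompact_Icc).inter_right
      (isClosed_le continuous_const (continuous_apply 0))
  obtain ⟨τ, ⟨-, hτ0⟩, hτ⟩ := exists_backward_orbit_of_isCompact hcont hcompact fun n => by
    obtain ⟨τ, hmem, horbit, m, hm⟩ := exists_orbit_segment hε ha hf hM n
    exact ⟨τ, ⟨fun i _ => hmem i, (mul_le_mul_of_nonneg_left (hprod m) hε.le).trans hm⟩, horbit⟩
  exact ⟨τ, (mul_pos hε hp).trans_le hτ0, hτ⟩

theorem exists_pos_le_prod_div_exp {a : ℕ → ℝ} (ha : ∀ i, 0 < a i) {l : ℝ}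
    (hl : (l : EReal) < liminf (fun n : ℕ =>
      ((1 / (n : ℝ) * ∑ i ∈ Finset.range n, Real.log (a i) : ℝ) : EReal)) atTop) :
    ∃ p > 0, ∀ n, p ≤ ∏ i ∈ Finset.range n, a i / Real.exp l := by
  have hprod (n : ℕ) : ∏ i ∈ Finset.range n, a i / Real.exp l =
      Real.exp (∑ i ∈ Finset.range n, Real.log (a i) - n * l) := by
    rw [Finset.prod_div_distrib, Real.exp_sub, Real.exp_sum, Real.exp_nat_mul]
    simp only [Real.exp_log (ha _), Finset.prod_const, Finset.card_range]
  have hev : ∀ᶠ n : ℕ in atTop, 0 ≤ ∑ i ∈ Finset.range n, Real.log (a i) - n * l := by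
    filter_upwards [eventually_lt_of_lt_liminf hl, eventually_gt_atTop 0] with n hn hn0
    rw [EReal.coe_lt_coe_iff, one_div, inv_mul_eq_div, lt_div_iff₀ (by exact_mod_cast hn0)] at hn
    linarith
  obtain ⟨b, hb⟩ := (isBoundedUnder_of_eventually_ge hev).bddBelow_range
  exact ⟨Real.exp b, Real.exp_pos b, fun n =>
    (Real.exp_le_exp.mpr (hb (Set.mem_range_self n))).trans_eq (hprod n).symm⟩

/-! ### The field recursion -/

/-- The sum of `e^{2mθ}` over the values `m` of `S^z` in the spin-`q/2` representation. -/
def partitionSum (q : ℕ) (θ : ℝ) : ℝ :=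
  ∑ j ∈ Finset.range (q + 1), Real.exp ((2 * j - q) * θ)

/-- The derivative of `partitionSum q`, so that `momentSum q θ / partitionSum q θ` is the mean
magnetization `2m` of a spin `q/2` in the field `θ`. -/
def momentSum (q : ℕ) (θ : ℝ) : ℝ :=
  ∑ j ∈ Finset.range (q + 1), (2 * j - q) * Real.exp ((2 * j - q) * θ)

/-- The weight of an up spin 1/2 in the symmetric space of `q + 1` spins 1/2, when each of the other
`q` has weight `e^θ` for up and `e^{-θ}` for down. By spin reversal `branchWeight q (-θ)` is the
weight of a down spin. -/
def branchWeight (q : ℕ) (θ : ℝ) : ℝ :=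
  ∑ j ∈ Finset.range (q + 1), ((j : ℝ) + 1) / (q + 1) * Real.exp ((2 * j - q) * θ)

/-- The field felt by one spin 1/2 of a vertex when its `q` other spins 1/2 feel the field `θ`:
half the logarithm of the ratio of the weights of up and down. -/
def branchField (q : ℕ) (θ : ℝ) : ℝ :=
  1 / 2 * Real.log (branchWeight q θ / branchWeight q (-θ))

theorem sum_range_two_mul_sub_neg {M : Type*} [AddCommMonoid M] (q : ℕ) (f : ℝ → M) :
    ∑ j ∈ Finset.range (q + 1), f (-(2 * j - q)) = ∑ j ∈ Finset.range (q + 1), f (2 * j - q) := by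
  rw [← Finset.sum_flip]
  refine Finset.sum_congr rfl fun j hj => ?_
  rw [Nat.cast_sub (Finset.mem_range_succ_iff.mp hj)]
  congr 1
  ring

theorem sum_range_two_mul_sub_eq_even_part (q : ℕ) (f : ℝ → ℝ) :
    ∑ j ∈ Finset.range (q + 1), f (2 * j - q) =
      ∑ j ∈ Finset.range (q + 1), (f (2 * j - q) + f (-(2 * j - q))) / 2 := by
  rw [← Finset.sum_div, Finset.sum_add_distrib, sum_range_two_mul_sub_neg, add_self_div_two]

theorem sum_range_two_mul_sub_sq (q : ℕ) :
    ∑ j ∈ Finset.range (q + 1), (2 * (j : ℝ) - q) ^ 2 = (q : ℝ) * (q + 1) * (q + 2) / 3 := by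
  have h (n : ℕ) : ∑ j ∈ Finset.range n, (2 * (j : ℝ) - q) ^ 2 =
      (n : ℝ) * (2 * (n - 1) * (2 * n - 1) / 3 - 2 * q * (n - 1) + (q : ℝ) ^ 2) := by
    induction n with
    | zero => simp
    | succ n ih => rw [Finset.sum_range_succ, ih]; push_cast; ring
  rw [h]
  push_cast
  ring

theorem partitionSum_pos (q : ℕ) (θ : ℝ) : 0 < partitionSum q θ :=
  Finset.sum_pos (fun _ _ => Real.exp_pos _) ⟨0, by simp⟩

theorem partitionSum_neg (q : ℕ) (θ : ℝ) : partitionSum q (-θ) = partitionSum q θ := by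
  rw [partitionSum, partitionSum, ← sum_range_two_mul_sub_neg q fun u => Real.exp (u * θ)]
  simp only [mul_neg, neg_mul]

theorem partitionSum_eq_sum_cosh (q : ℕ) (θ : ℝ) :
    partitionSum q θ = ∑ j ∈ Finset.range (q + 1), Real.cosh ((2 * j - q) * θ) := by
  rw [partitionSum, sum_range_two_mul_sub_eq_even_part q fun u => Real.exp (u * θ)]
  simp only [Real.cosh_eq, neg_mul]

theorem momentSum_eq_sum_sinh (q : ℕ) (θ : ℝ) :
    momentSum q θ =
      ∑ j ∈ Finset.range (q + 1), (2 * (j : ℝ) - q) * Real.sinh ((2 * j - q) * θ) := by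
  rw [momentSum, sum_range_two_mul_sub_eq_even_part q fun u => u * Real.exp (u * θ)]
  refine Finset.sum_congr rfl fun j _ => ?_
  rw [Real.sinh_eq, neg_mul (_ - _) θ]
  ring

theorem partitionSum_le_mul_cosh (q : ℕ) (θ : ℝ) :
    partitionSum q θ ≤ (q + 1) * Real.cosh (q * θ) := by
  rw [partitionSum_eq_sum_cosh]
  refine (Finset.sum_le_card_nsmul _ _ (Real.cosh (q * θ)) fun j hj => ?_).trans_eq (by simp)
  have hj' : (j : ℝ) ≤ q := by exact_mod_cast Finset.mem_range_succ_iff.mp hj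
  rw [Real.cosh_le_cosh, abs_mul, abs_mul]
  refine mul_le_mul_of_nonneg_right ?_ (abs_nonneg θ)
  rw [Nat.abs_cast, abs_le]
  constructor <;> linarith [(Nat.cast_nonneg j : (0 : ℝ) ≤ j)]

theorem mul_le_momentSum (q : ℕ) {θ : ℝ} (hθ : 0 ≤ θ) :
    q * (q + 1) * (q + 2) / 3 * θ ≤ momentSum q θ := by
  rw [momentSum_eq_sum_sinh, ← sum_range_two_mul_sub_sq, Finset.sum_mul]
  refine Finset.sum_le_sum fun j _ => ?_
  generalize (2 * (j : ℝ) - q) = u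
  rw [pow_two, mul_assoc]
  rcases le_total 0 u with hu | hu
  · exact mul_le_mul_of_nonneg_left (Real.self_le_sinh_iff.mpr (mul_nonneg hu hθ)) hu
  · exact mul_le_mul_of_nonpos_left
      (Real.sinh_le_self_iff.mpr (mul_nonpos_of_nonpos_of_nonneg hu hθ)) hu

-- Chebyshev's correlation argument: the difference of the two sides is half of a double sum of
-- products of factors with equal signs.
theorem sum_mul_exp_mul_sum_exp_le {ι : Type*} (s : Finset ι) (u : ι → ℝ) {η θ : ℝ} (h : η ≤ θ) :
    (∑ i ∈ s, u i * Real.exp (u i * η)) * ∑ i ∈ s, Real.exp (u i * θ) ≤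
      (∑ i ∈ s, u i * Real.exp (u i * θ)) * ∑ i ∈ s, Real.exp (u i * η) := by
  have hnonneg (x y : ℝ) : 0 ≤ (x - y) * (Real.exp (x * θ) * Real.exp (y * η) -
      Real.exp (x * η) * Real.exp (y * θ)) := by
    rw [← Real.exp_add, ← Real.exp_add]
    rcases le_total x y with hxy | hxy
    · refine mul_nonneg_of_nonpos_of_nonpos (by linarith) (sub_nonpos.mpr (Real.exp_le_exp.mpr ?_))
      nlinarith
    · refine mul_nonneg (by linarith) (sub_nonneg.mpr (Real.exp_le_exp.mpr ?_))
      nlinarith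
  have hdouble : 0 ≤ ∑ i ∈ s, ∑ j ∈ s, (u i - u j) *
      (Real.exp (u i * θ) * Real.exp (u j * η) - Real.exp (u i * η) * Real.exp (u j * θ)) :=
    Finset.sum_nonneg fun i _ => Finset.sum_nonneg fun j _ => hnonneg (u i) (u j)
  have hexpand : ∑ i ∈ s, ∑ j ∈ s, (u i - u j) *
      (Real.exp (u i * θ) * Real.exp (u j * η) - Real.exp (u i * η) * Real.exp (u j * θ)) =
      (∑ i ∈ s, u i * Real.exp (u i * θ)) * (∑ j ∈ s, Real.exp (u j * η)) -
      (∑ i ∈ s, u i * Real.exp (u i * η)) * (∑ j ∈ s, Real.exp (u j * θ)) -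
      (∑ i ∈ s, Real.exp (u i * θ)) * (∑ j ∈ s, u j * Real.exp (u j * η)) +
      (∑ i ∈ s, Real.exp (u i * η)) * ∑ j ∈ s, u j * Real.exp (u j * θ) := by
    simp only [Finset.sum_mul_sum, ← Finset.sum_sub_distrib, ← Finset.sum_add_distrib]
    exact Finset.sum_congr rfl fun i _ => Finset.sum_congr rfl fun j _ => by ring
  linarith

theorem monotone_momentSum_div_partitionSum (q : ℕ) :
    Monotone fun θ => momentSum q θ / partitionSum q θ := fun η θ h => by
  rw [div_le_div_iff₀ (partitionSum_pos q η) (partitionSum_pos q θ)]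
  exact sum_mul_exp_mul_sum_exp_le _ _ h

theorem le_momentSum_div_partitionSum (q : ℕ) {δ θ : ℝ} (hθ : 0 ≤ θ) (hδ : q * θ ≤ δ) :
    q * (q + 2) / (3 * Real.cosh δ) * θ ≤ momentSum q θ / partitionSum q θ := by
  have hpart : partitionSum q θ ≤ (q + 1) * Real.cosh δ := by
    refine (partitionSum_le_mul_cosh q θ).trans ?_
    gcongr
    have hqθ : 0 ≤ q * θ := by positivity
    rwa [Real.cosh_le_cosh, abs_of_nonneg hqθ, abs_of_nonneg (hqθ.trans hδ)]
  calc q * (q + 2) / (3 * Real.cosh δ) * θ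
      = q * (q + 1) * (q + 2) / 3 * θ / ((q + 1) * Real.cosh δ) := by
        field_simp
    _ ≤ momentSum q θ / partitionSum q θ :=
        div_le_div₀ ((by positivity : (0 : ℝ) ≤ _).trans (mul_le_momentSum q hθ))
          (mul_le_momentSum q hθ) (partitionSum_pos q θ) hpart

theorem branchWeight_pos (q : ℕ) (θ : ℝ) : 0 < branchWeight q θ :=
  Finset.sum_pos (fun _ _ => by positivity) ⟨0, by simp⟩

theorem branchWeight_neg (q : ℕ) (θ : ℝ) :
    branchWeight q (-θ) =
      ∑ j ∈ Finset.range (q + 1), ((q : ℝ) + 1 - j) / (q + 1) * Real.exp ((2 * j - q) * θ) := by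
  rw [branchWeight, ← Finset.sum_flip]
  refine Finset.sum_congr rfl fun j hj => ?_
  rw [Nat.cast_sub (Finset.mem_range_succ_iff.mp hj)]
  congr 2 <;> ring

theorem branchWeight_add_branchWeight_neg (q : ℕ) (θ : ℝ) :
    branchWeight q θ + branchWeight q (-θ) = (q + 2) / (q + 1) * partitionSum q θ := by
  rw [branchWeight_neg, branchWeight, partitionSum, ← Finset.sum_add_distrib, Finset.mul_sum]
  exact Finset.sum_congr rfl fun j _ => by ring

theorem branchWeight_sub_branchWeight_neg (q : ℕ) (θ : ℝ) :
    branchWeight q θ - branchWeight q (-θ) = 1 / (q + 1) * momentSum q θ := by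
  rw [branchWeight_neg, branchWeight, momentSum, ← Finset.sum_sub_distrib, Finset.mul_sum]
  exact Finset.sum_congr rfl fun j _ => by ring

theorem branchWeight_le_mul_branchWeight_neg (q : ℕ) (θ : ℝ) :
    branchWeight q θ ≤ (q + 1) * branchWeight q (-θ) := by
  rw [branchWeight_neg, branchWeight, Finset.mul_sum]
  refine Finset.sum_le_sum fun j hj => ?_
  have hj' : (j : ℝ) ≤ q := by exact_mod_cast Finset.mem_range_succ_iff.mp hj
  rw [← mul_assoc]
  gcongr
  rw [mul_div_cancel₀ _ (by positivity), div_le_iff₀ (by positivity)]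
  nlinarith [(Nat.cast_nonneg j : (0 : ℝ) ≤ j)]

theorem continuous_branchWeight (q : ℕ) : Continuous (branchWeight q) := by
  unfold branchWeight
  fun_prop

theorem continuous_branchField (q : ℕ) : Continuous (branchField q) := by
  refine continuous_const.mul (Continuous.log ?_ fun θ =>
    (div_pos (branchWeight_pos q _) (branchWeight_pos q _)).ne')
  exact (continuous_branchWeight q).div₀ ((continuous_branchWeight q).comp continuous_neg)
    fun θ => (branchWeight_pos q _).ne'

theorem branchField_neg (q : ℕ) (θ : ℝ) : branchField q (-θ) = -branchField q θ := by
  rw [branchField, branchField, neg_neg, ← inv_div (branchWeight q θ), Real.log_inv, mul_neg]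

theorem branchField_neg_one_pow_mul (q m : ℕ) (θ : ℝ) :
    branchField q ((-1) ^ m * θ) = (-1) ^ m * branchField q θ := by
  rcases neg_one_pow_eq_or ℝ m with h | h <;> simp [h, branchField_neg]

theorem branchField_le_log (q : ℕ) (θ : ℝ) : branchField q θ ≤ Real.log (q + 1) := by
  have hratio : branchWeight q θ / branchWeight q (-θ) ≤ q + 1 :=
    (div_le_iff₀ (branchWeight_pos q _)).mpr (branchWeight_le_mul_branchWeight_neg q θ)
  have hlog := Real.log_le_log (div_pos (branchWeight_pos q _) (branchWeight_pos q _)) hratio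
  have hnonneg : 0 ≤ Real.log ((q : ℝ) + 1) := Real.log_nonneg (by simp)
  rw [branchField]
  linarith

theorem sub_div_add_le_half_log_div {a b : ℝ} (hb : 0 < b) (hab : b ≤ a) :
    (a - b) / (a + b) ≤ 1 / 2 * Real.log (a / b) := by
  have ha : 0 < a := hb.trans_le hab
  have hlt : (a - b) / (a + b) < 1 := (div_lt_one (by positivity)).mpr (by linarith)
  have h := Real.sum_range_le_log_div (div_nonneg (sub_nonneg.mpr hab) (by positivity)) hlt 1
  have hadd : 1 + (a - b) / (a + b) = 2 * a / (a + b) := by field_simp; ring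
  have hsub : 1 - (a - b) / (a + b) = 2 * b / (a + b) := by field_simp; ring
  rw [hadd, hsub, div_div_div_cancel_right₀ (by positivity), mul_div_mul_left _ _ two_ne_zero] at h
  simpa using h

theorem momentSum_div_le_branchField (q : ℕ) {θ : ℝ} (hθ : 0 ≤ θ) :
    momentSum q θ / partitionSum q θ / (q + 2) ≤ branchField q θ := by
  have hsub := branchWeight_sub_branchWeight_neg q θ
  have hmoment : 0 ≤ momentSum q θ := (by positivity : (0 : ℝ) ≤ _).trans (mul_le_momentSum q hθ)
  have hle : branchWeight q (-θ) ≤ branchWeight q θ :=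
    sub_nonneg.mp (hsub.symm ▸ mul_nonneg (by positivity) hmoment)
  refine le_trans (le_of_eq ?_) (sub_div_add_le_half_log_div (branchWeight_pos q _) hle)
  rw [hsub, branchWeight_add_branchWeight_neg]
  have := partitionSum_pos q θ
  field_simp

theorem min_le_branchField {q : ℕ} (hq : 0 < q) {δ : ℝ} (hδ : 0 < δ) {θ : ℝ} (hθ : 0 ≤ θ) :
    min (q * θ) δ / (3 * Real.cosh δ) ≤ branchField q θ := by
  have hq' : (0 : ℝ) < q := by exact_mod_cast hq
  set η := min θ (δ / q) with hη
  have hmin : min (q * θ) δ = q * η := by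
    rw [hη, mul_min_of_nonneg _ _ hq'.le, mul_div_cancel₀ _ hq'.ne']
  have hη0 : 0 ≤ η := le_min hθ (by positivity)
  calc min (q * θ) δ / (3 * Real.cosh δ)
      = q * (q + 2) / (3 * Real.cosh δ) * η / (q + 2) := by rw [hmin]; field_simp
    _ ≤ momentSum q η / partitionSum q η / (q + 2) := by
        gcongr
        exact le_momentSum_div_partitionSum q hη0 (hmin.symm.trans_le (min_le_right _ _))
    _ ≤ momentSum q θ / partitionSum q θ / (q + 2) := by
        gcongr ?_ / _
        exact monotone_momentSum_div_partitionSum q (min_le_left _ _)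
    _ ≤ branchField q θ := momentSum_div_le_branchField q hθ

theorem branchWeight_eq_sqrt_mul_exp (q : ℕ) (θ : ℝ) :
    branchWeight q θ =
      √(branchWeight q θ * branchWeight q (-θ)) * Real.exp (branchField q θ) := by
  have hup := branchWeight_pos q θ
  have hdown := branchWeight_pos q (-θ)
  have hexp : Real.exp (branchField q θ) = √(branchWeight q θ / branchWeight q (-θ)) := by
    rw [branchField, Real.sqrt_eq_rpow, Real.rpow_def_of_pos (div_pos hup hdown), mul_comm]
  rw [hexp, ← Real.sqrt_mul (by positivity)]
  refine (Real.sqrt_eq_iff_mul_self_eq_of_pos hup).mpr ?_ |>.symm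
  field_simp

theorem exists_branchField_orbit {q : ℕ → ℕ} (hq : ∀ i, 0 < q i)
    (hlim : 0 < liminf (fun n : ℕ =>
      ((1 / (n : ℝ) * ∑ i ∈ Finset.range n, Real.log (q i / 3) : ℝ) : EReal)) atTop) :
    ∃ τ : ℕ → ℝ, 0 < τ 0 ∧ ∀ i, τ i = branchField (q i) (τ (i + 1)) := by
  obtain ⟨l, hl0, hl⟩ := EReal.lt_iff_exists_real_btwn.mp hlim
  obtain ⟨p, hp, hprod⟩ := exists_pos_le_prod_div_exp
    (fun i => div_pos (Nat.cast_pos.mpr (hq i)) three_pos) hl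
  have hexp : 1 < Real.exp l := Real.one_lt_exp_iff.mpr (EReal.coe_pos.mp hl0)
  set δ := Real.arcosh (Real.exp l)
  have hδ : 0 < δ := Real.arcosh_pos hexp
  refine exists_pos_backward_orbit (ε := δ / (3 * Real.exp l)) (by positivity) hp
    (fun i => continuous_branchField (q i))
    (fun i => div_pos (div_pos (Nat.cast_pos.mpr (hq i)) three_pos) (Real.exp_pos l))
    (fun i x hx => ?_) (fun i x => branchField_le_log (q i) x) hprod
  calc min (q i / 3 / Real.exp l * x) (δ / (3 * Real.exp l))
      = min (q i * x) δ / (3 * Real.exp l) := by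
        rw [← min_div_div_right (by positivity), div_div, div_mul_eq_mul_div]
    _ = min (q i * x) δ / (3 * Real.cosh δ) := by rw [Real.cosh_arcosh hexp.le]
    _ ≤ branchField (q i) x := min_le_branchField (hq i) hδ hx

/-! ### Rooted trees -/

section Tree

variable {V : Type*} {G : SimpleGraph V} {o : V}

theorem IsChild.parent_unique (hG : G.IsTree) {x y v : V} (hx : IsChild G o x v)
    (hy : IsChild G o y v) : x = y := by
  have exists_path {z : V} (hz : IsChild G o z v) :
      ∃ p : G.Walk o v, p.IsPath ∧ p.penultimate = z := by
    obtain ⟨p, hp⟩ := hG.connected.exists_walk_length_eq_dist o z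
    refine ⟨p.concat hz.1, SimpleGraph.Walk.isPath_of_length_eq_dist _ ?_, by simp⟩
    rw [SimpleGraph.Walk.length_concat, hp, hz.2]
  obtain ⟨p, hp, rfl⟩ := exists_path hx
  obtain ⟨p', hp', rfl⟩ := exists_path hy
  rw [(hG.existsUnique_path o v).unique hp hp']

theorem exists_isChild (hG : G.Connected) {v : V} {n : ℕ} (hv : G.dist o v = n + 1) :
    ∃ x, IsChild G o x v ∧ G.dist o x = n := by
  obtain ⟨p, hp⟩ := hG.exists_walk_length_eq_dist v o
  rw [SimpleGraph.dist_comm, hv] at hp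
  cases p with
  | nil => simp at hp
  | @cons _ w _ hadj q =>
    rw [SimpleGraph.Walk.length_cons] at hp
    have hw : G.dist o w ≤ q.length := G.dist_comm (u := w) ▸ SimpleGraph.dist_le q
    have htri := hG.dist_triangle (u := o) (v := w) (w := v)
    rw [SimpleGraph.dist_eq_one_iff_adj.mpr hadj.symm] at htri
    exact ⟨w, ⟨hadj.symm, by omega⟩, by omega⟩

theorem isChild_or_isChild (hG : G.IsTree) {x y : V} (h : G.Adj x y) :
    IsChild G o x y ∨ IsChild G o y x :=
  (hG.dist_eq_dist_add_one_of_adj o h).elim (fun hx => .inr ⟨h.symm, hx⟩) fun hy => .inl ⟨h, hy⟩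

variable [G.LocallyFinite]

theorem exists_dist_eq [Infinite V] (hG : G.Connected) (o : V) (n : ℕ) :
    ∃ v, G.dist o v = n := by
  classical
  obtain ⟨v, hv⟩ := Infinite.exists_notMem_finset (ball G o n)
  rw [mem_ball G o hG, not_le] at hv
  refine Nat.decreasingInduction (motive := fun k _ => ∃ v, G.dist o v = k)
    (fun k _ ⟨w, hw⟩ => ?_) ⟨v, rfl⟩ hv.le
  obtain ⟨x, -, hx⟩ := exists_isChild hG hw
  exact ⟨x, hx⟩

theorem exists_dist_eq_and_two_le_degree [Infinite V] (hG : G.Connected) (o : V) (n : ℕ) :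
    ∃ x, G.dist o x = n + 1 ∧ 2 ≤ G.degree x := by
  obtain ⟨v, hv⟩ := exists_dist_eq hG o (n + 2)
  obtain ⟨x, hxv, hx⟩ := exists_isChild hG hv
  obtain ⟨y, hyx, hy⟩ := exists_isChild hG hx
  refine ⟨x, hx, ?_⟩
  rw [← G.card_neighborFinset_eq_degree]
  refine Finset.one_lt_card.mpr ⟨v, by simpa using hxv.1, y, by simpa using hyx.1.symm, ?_⟩
  rintro rfl
  omega

theorem ball_mono [DecidableEq V] (hG : G.Connected) {m n : ℕ} (h : m ≤ n) :
    ball G o m ⊆ ball G o n := by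
  intro x hx
  rw [mem_ball G o hG] at hx ⊢
  exact hx.trans h

theorem exists_subset_ball [DecidableEq V] (hG : G.Connected) (o : V) (S : Finset V) :
    ∃ n, S ⊆ ball G o n :=
  ⟨S.sup fun x => G.dist o x, fun _ hx =>
    (mem_ball G o hG _ _).mpr (Finset.le_sup (f := fun x => G.dist o x) hx)⟩

variable (G o) in
/-- The finset of the children of `x`. -/
def children (x : V) : Finset V := (G.neighborFinset x).filter fun y => G.dist o y = G.dist o x + 1

theorem mem_children {x y : V} : y ∈ children G o x ↔ IsChild G o x y := by
  simp [children, IsChild]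

theorem mem_children_self {y : V} : y ∈ children G o o ↔ G.Adj o y := by
  rw [mem_children]
  exact ⟨fun h => h.1, fun h => ⟨h, by
    rw [SimpleGraph.dist_self, SimpleGraph.dist_eq_one_iff_adj.mpr h]⟩⟩

theorem children_eq_map_erase [DecidableEq V] (hG : G.IsTree) {p v : V} (hpv : IsChild G o p v) :
    children G o v = ((Finset.univ : Finset (G.neighborSet v)).erase ⟨p, hpv.1.symm⟩).map
      (Function.Embedding.subtype _) := by
  ext y
  simp only [mem_children, Finset.mem_map, Finset.mem_erase, Finset.mem_univ, and_true,
    Function.Embedding.coe_subtype, Subtype.exists, exists_and_right, exists_eq_right, ne_eq,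
    SimpleGraph.mem_neighborSet, Subtype.ext_iff]
  constructor
  · rintro ⟨hadj, hdist⟩
    refine ⟨hadj, ?_⟩
    rintro rfl
    have := hpv.2
    omega
  · rintro ⟨hadj, hne⟩
    exact (isChild_or_isChild (o := o) hG hadj).resolve_right
      fun h => hne (h.parent_unique hG hpv)

theorem prod_children_eq_mul [DecidableEq V] {M : Type*} [CommMonoid M] (hG : G.IsTree)
    {T : Finset V} {p v : V} (hp : p ∈ T) (hpv : IsChild G o p v) (φ : V → V → M) :
    ∏ x ∈ T, ∏ y ∈ children G o x, φ x y =
      φ p v * ∏ x ∈ T, ∏ y ∈ (children G o x).erase v, φ x y := by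
  rw [← Finset.mul_prod_erase T _ hp, ← Finset.mul_prod_erase T _ hp,
    ← Finset.mul_prod_erase _ _ (mem_children.mpr hpv), mul_assoc]
  congr 2
  refine Finset.prod_congr rfl fun x hx => ?_
  rw [Finset.erase_eq_of_notMem fun hv =>
    (Finset.mem_erase.mp hx).1 ((mem_children.mp hv).parent_unique hG hpv)]

end Tree

/-! ### Integrating out one vertex -/

section Vertex

variable {ι : Type*} [Fintype ι]

/-- The number of up spins of a state `s` of spins 1/2. -/
def numUp (s : ι → Bool) : ℕ := (Finset.univ.filter fun i => s i = true).card

theorem numUp_le_card (s : ι → Bool) : numUp s ≤ Fintype.card ι := Finset.card_le_univ _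

theorem symAmplitude_eq_ite_numUp (k : ℕ) (s : ι → Bool) :
    symAmplitude k s = if numUp s = k then ((1 / √((Fintype.card ι).choose k) : ℝ) : ℂ) else 0 :=
  rfl

theorem numUp_eq_toNat_add [DecidableEq ι] (s : ι → Bool) (p : ι) :
    numUp s = (s p).toNat + numUp fun i : {i // i ≠ p} => s i := by
  rw [numUp, numUp, Finset.card_filter, Finset.card_filter, Fintype.sum_eq_add_sum_subtype_ne _ p]
  cases s p <;> rfl

theorem numUp_update [DecidableEq ι] (s : ι → Bool) (p : ι) (c : Bool) :
    numUp (Function.update s p c) = c.toNat + numUp fun i : {i // i ≠ p} => s i := by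
  rw [numUp_eq_toNat_add _ p, Function.update_self]
  congr 2
  funext i
  exact Function.update_of_ne i.2 _ _

theorem eq_of_numUp_eq {s s' : ι → Bool} {p : ι} (hoff : ∀ i, i ≠ p → s i = s' i)
    (hnum : numUp s = numUp s') : s = s' := by
  classical
  rw [numUp_eq_toNat_add s p, numUp_eq_toNat_add s' p,
    funext fun i : {i // i ≠ p} => hoff i i.2, Nat.add_right_cancel_iff] at hnum
  funext i
  rcases eq_or_ne i p with rfl | hi
  · revert hnum
    cases s i <;> cases s' i <;> decide
  · exact hoff i hi

theorem sum_symAmplitude_mul_symAmplitude (s s' : ι → Bool) :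
    ∑ e ∈ Finset.range (Fintype.card ι + 1), symAmplitude e s * symAmplitude e s' =
      if numUp s = numUp s' then 1 / ((Fintype.card ι).choose (numUp s) : ℂ) else 0 := by
  simp only [symAmplitude_eq_ite_numUp, ite_mul, zero_mul]
  rw [Finset.sum_ite_eq, if_pos (Finset.mem_range_succ_iff.mpr (numUp_le_card s)), mul_ite,
    mul_zero]
  refine if_congr eq_comm ?_ rfl
  rw [← Complex.ofReal_mul, div_mul_div_comm, one_mul, Real.mul_self_sqrt (Nat.cast_nonneg _)]
  push_cast
  rfl

theorem symAmplitude_mul_self (k : ℕ) (s : ι → Bool) :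
    symAmplitude k s * symAmplitude k s =
      if numUp s = k then 1 / ((Fintype.card ι).choose k : ℂ) else 0 := by
  rw [symAmplitude_eq_ite_numUp, ite_mul_ite, mul_zero, ← Complex.ofReal_mul, div_mul_div_comm,
    one_mul, Real.mul_self_sqrt (Nat.cast_nonneg _)]
  push_cast
  rfl

/-- The weights `e^θ` of up and `e^{-θ}` of down in the field `θ`. -/
def legWeight (θ : ℝ) (b : Bool) : ℂ := (Real.exp (if b then θ else -θ) : ℝ)

theorem prod_legWeight (θ : ℝ) (s : ι → Bool) :
    ∏ i, legWeight θ (s i) = (Real.exp ((2 * numUp s - Fintype.card ι) * θ) : ℝ) := by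
  have hcard := Finset.card_filter_add_card_filter_not (s := (Finset.univ : Finset ι))
    (fun i => s i = true)
  simp only [legWeight]
  rw [← Complex.ofReal_prod, ← Real.exp_sum, Finset.sum_ite, Finset.sum_const, Finset.sum_const,
    ← Finset.card_univ, ← hcard, numUp]
  push_cast
  simp only [nsmul_eq_mul]
  congr 2
  ring

theorem sum_apply_numUp [DecidableEq ι] (f : ℕ → ℂ) :
    ∑ s : ι → Bool, f (numUp s) =
      ∑ j ∈ Finset.range (Fintype.card ι + 1), ((Fintype.card ι).choose j : ℂ) * f j := by
  have hcard : ∑ s : ι → Bool, f (numUp s) = ∑ S ∈ (Finset.univ : Finset ι).powerset, f S.card := by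
    refine Finset.sum_nbij' (fun s => Finset.univ.filter fun i => s i = true)
      (fun S i => decide (i ∈ S)) ?_ ?_ ?_ ?_ fun _ _ => rfl <;> simp
  rw [hcard, Finset.sum_powerset_apply_card, Finset.card_univ]
  simp only [nsmul_eq_mul]

theorem choose_mul_one_div_choose_succ_succ {q j : ℕ} (hj : j ≤ q) :
    (q.choose j : ℝ) * (1 / (q + 1).choose (j + 1)) = (j + 1) / (q + 1) := by
  have hchoose : ((q + 1).choose (j + 1) : ℝ) ≠ 0 :=
    Nat.cast_ne_zero.mpr (Nat.choose_pos (Nat.succ_le_succ hj)).ne'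
  rw [mul_one_div, div_eq_div_iff hchoose (by positivity), mul_comm ((j : ℝ) + 1),
    mul_comm (q.choose j : ℝ)]
  exact_mod_cast Nat.add_one_mul_choose_eq q j

theorem choose_mul_one_div_choose_succ {q j : ℕ} (hj : j ≤ q) :
    (q.choose j : ℝ) * (1 / (q + 1).choose j) = (q + 1 - j) / (q + 1) := by
  have hchoose : ((q + 1).choose j : ℝ) ≠ 0 :=
    Nat.cast_ne_zero.mpr (Nat.choose_pos (hj.trans q.le_succ)).ne'
  rw [mul_one_div, div_eq_div_iff hchoose (by positivity), mul_comm ((q : ℝ) + 1 - j)]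
  have h := congrArg (Nat.cast (R := ℝ)) (Nat.choose_mul_succ_eq q j)
  push_cast [Nat.cast_sub (hj.trans q.le_succ)] at h
  exact h

theorem sum_ite_mul_prod_legWeight_eq_branchWeight [DecidableEq ι] {q : ℕ}
    (hq : Fintype.card ι = q + 1) (p : ι) (θ : ℝ) (c : Bool) :
    ∑ s : ι → Bool, (if s p = c then
        1 / ((q + 1).choose (numUp s) : ℂ) * ∏ i ∈ Finset.univ.erase p, legWeight θ (s i) else 0) =
      (branchWeight q (if c then θ else -θ) : ℝ) := by
  have hcard : Fintype.card {i // i ≠ p} = q := by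
    simp [Fintype.card_subtype_compl, hq]
  have hsplit : ∑ s : ι → Bool, (if s p = c then
        1 / ((q + 1).choose (numUp s) : ℂ) * ∏ i ∈ Finset.univ.erase p, legWeight θ (s i) else 0) =
      ∑ t : {i // i ≠ p} → Bool,
        1 / ((q + 1).choose (c.toNat + numUp t) : ℂ) * ∏ i, legWeight θ (t i) := by
    rw [Fintype.sum_equiv (Equiv.funSplitAt p Bool) _ (fun z => if z.1 = c then
      1 / ((q + 1).choose (z.1.toNat + numUp z.2) : ℂ) * ∏ i, legWeight θ (z.2 i) else 0),
      Fintype.sum_prod_type_right]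
    · simp only [Finset.sum_ite_eq', Finset.mem_univ, if_true]
    · intro s
      rw [Finset.prod_subtype (p := fun i => i ≠ p) _ (by simp), numUp_eq_toNat_add s p]
      rfl
  simp only [hsplit, prod_legWeight]
  rw [sum_apply_numUp fun j => 1 / ((q + 1).choose (c.toNat + j) : ℂ) *
    (Real.exp ((2 * j - Fintype.card {i // i ≠ p}) * θ) : ℝ), hcard]
  cases c
  · rw [if_neg Bool.false_ne_true, branchWeight_neg, Complex.ofReal_sum]
    refine Finset.sum_congr rfl fun j hj => ?_
    rw [← choose_mul_one_div_choose_succ (Finset.mem_range_succ_iff.mp hj), Bool.toNat_false,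
      zero_add, ← mul_assoc]
    push_cast
    rfl
  · rw [if_pos rfl, branchWeight, Complex.ofReal_sum]
    refine Finset.sum_congr rfl fun j hj => ?_
    rw [← choose_mul_one_div_choose_succ_succ (Finset.mem_range_succ_iff.mp hj), Bool.toNat_true,
      add_comm 1, ← mul_assoc]
    push_cast
    rfl

theorem singlet_mul_singlet (a a' c : Bool) :
    singlet a c * singlet a' c = if a = a' ∧ c = !a then 1 else 0 := by
  cases a <;> cases a' <;> cases c <;> simp [singlet]

theorem sum_symAmplitude_mul_prod_legWeight [DecidableEq ι] (p : ι) (θ : ℝ) (s s' : ι → Bool) :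
    (∑ e ∈ Finset.range (Fintype.card ι + 1), symAmplitude e s * symAmplitude e s') *
        ∏ i ∈ Finset.univ.erase p, (if s i = s' i then legWeight θ (s i) else 0) =
      if s = s' then 1 / ((Fintype.card ι).choose (numUp s) : ℂ) *
        ∏ i ∈ Finset.univ.erase p, legWeight θ (s i) else 0 := by
  rw [sum_symAmplitude_mul_symAmplitude]
  by_cases hs : s = s'
  · subst hs
    simp only [if_true]
  · rw [if_neg hs, Finset.prod_ite_zero, ite_zero_mul_ite_zero, if_neg]
    exact fun h => hs (eq_of_numUp_eq (p := p) (fun i hi => h.2 i (by simpa using hi)) h.1)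

/-- The field changes sign because the singlet on the leg `p` reverses spins. -/
theorem sum_vertex [DecidableEq ι] {q : ℕ} (hq : Fintype.card ι = q + 1) (p : ι) (θ : ℝ)
    (a a' : Bool) :
    ∑ e ∈ Finset.range (Fintype.card ι + 1), ∑ s : ι → Bool, ∑ s' : ι → Bool,
      symAmplitude e s * symAmplitude e s' * (singlet a (s p) * singlet a' (s' p)) *
        ∏ i ∈ Finset.univ.erase p, (if s i = s' i then legWeight θ (s i) else 0) =
      (√(branchWeight q θ * branchWeight q (-θ)) : ℝ) *
        if a = a' then legWeight (-branchField q θ) a else 0 := by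
  calc _ = ∑ s : ι → Bool, ∑ s' : ι → Bool, singlet a (s p) * singlet a' (s' p) *
          ((∑ e ∈ Finset.range (Fintype.card ι + 1), symAmplitude e s * symAmplitude e s') *
          ∏ i ∈ Finset.univ.erase p, (if s i = s' i then legWeight θ (s i) else 0)) := by
        rw [Finset.sum_comm]
        refine Finset.sum_congr rfl fun s _ => ?_
        rw [Finset.sum_comm]
        refine Finset.sum_congr rfl fun s' _ => ?_
        rw [← Finset.sum_mul, ← Finset.sum_mul]
        ring
    _ = ∑ s : ι → Bool, singlet a (s p) * singlet a' (s p) *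
          (1 / ((q + 1).choose (numUp s) : ℂ) *
            ∏ i ∈ Finset.univ.erase p, legWeight θ (s i)) := by
        simp only [sum_symAmplitude_mul_prod_legWeight, mul_ite, mul_zero, Finset.sum_ite_eq,
          Finset.mem_univ, if_true]
        rw [hq]
    _ = if a = a' then ((branchWeight q (if !a then θ else -θ) : ℝ) : ℂ) else 0 := by
        rw [← sum_ite_mul_prod_legWeight_eq_branchWeight hq p]
        simp only [singlet_mul_singlet, ite_and, ite_mul, one_mul, zero_mul]
        split_ifs <;> simp
    _ = _ := by
        rw [mul_ite, mul_zero, legWeight, ← Complex.ofReal_mul]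
        congr 2
        cases a
        · simpa using branchWeight_eq_sqrt_mul_exp q θ
        · simpa [branchField_neg, mul_comm] using branchWeight_eq_sqrt_mul_exp q (-θ)

theorem sum_symAmplitude_mul_self_mul_prod_legWeight [DecidableEq ι] {m : ℕ}
    (hm : m ≤ Fintype.card ι) (θ : ℝ) :
    ∑ s : ι → Bool, ∑ s' : ι → Bool, symAmplitude m s * symAmplitude m s' *
        ∏ i, (if s i = s' i then legWeight θ (s i) else 0) =
      (Real.exp ((2 * m - Fintype.card ι) * θ) : ℝ) := by
  have hchoose : ((Fintype.card ι).choose m : ℂ) ≠ 0 :=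
    Nat.cast_ne_zero.mpr (Nat.choose_pos hm).ne'
  have hprod (s s' : ι → Bool) : ∏ i, (if s i = s' i then legWeight θ (s i) else 0) =
      if s = s' then ∏ i, legWeight θ (s i) else 0 := by
    simp [Finset.prod_ite_zero, funext_iff]
  simp only [hprod, mul_ite, mul_zero, Finset.sum_ite_eq, Finset.mem_univ, if_true,
    symAmplitude_mul_self, prod_legWeight, ite_mul, zero_mul]
  rw [sum_apply_numUp fun j => if j = m then 1 / ((Fintype.card ι).choose m : ℂ) *
    (Real.exp ((2 * j - Fintype.card ι) * θ) : ℝ) else 0]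
  simp only [mul_ite, mul_zero]
  rw [Finset.sum_ite_eq', if_pos (Finset.mem_range_succ_iff.mpr hm), ← mul_assoc, mul_one_div,
    div_self hchoose, one_mul]

end Vertex

/-! ### Families indexed by `insert v T` -/

section Glue

variable {V : Type*} [DecidableEq V] {v : V} {T : Finset V} (F : V → Type*)

/-- The family on `insert v T` with the value `a` at `v` and the values of `f` on `T`. It is used
for the configurations and for the leg states of a finite tree with one vertex added. -/
def glue (a : F v) (f : (x : T) → F x) : (x : ↥(insert v T)) → F x := fun x =>
  if h : (x : V) = v then cast (congrArg F h.symm) a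
  else f ⟨x, Finset.mem_of_mem_insert_of_ne x.2 h⟩

theorem glue_self (a : F v) (f : (x : T) → F x) (h : v ∈ insert v T) :
    glue F a f ⟨v, h⟩ = a := by
  simp [glue]

theorem glue_of_mem (hv : v ∉ T) (a : F v) (f : (x : T) → F x) {x : V} (hx : x ∈ T)
    (h : x ∈ insert v T) : glue F a f ⟨x, h⟩ = f ⟨x, hx⟩ := by
  simp [glue, ne_of_mem_of_not_mem hx hv]

/-- `glue` as an equivalence. -/
def glueEquiv (hv : v ∉ T) : (((x : T) → F x) × F v) ≃ ((x : ↥(insert v T)) → F x) where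
  toFun z := glue F z.2 z.1
  invFun g := (fun x => g ⟨x, Finset.mem_insert_of_mem x.2⟩, g ⟨v, Finset.mem_insert_self v T⟩)
  left_inv z := Prod.ext (funext fun x => glue_of_mem F hv _ _ x.2 _) (glue_self F _ _ _)
  right_inv g := by
    funext ⟨x, hx⟩
    rcases Finset.mem_insert.mp hx with rfl | h
    · exact glue_self F _ _ _
    · exact glue_of_mem F hv _ _ h _

theorem sum_glue [∀ x, Fintype (F x)] (hv : v ∉ T) {M : Type*} [AddCommMonoid M]
    (Φ : ((x : ↥(insert v T)) → F x) → M) :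
    ∑ g, Φ g = ∑ f : (x : T) → F x, ∑ a : F v, Φ (glue F a f) := by
  rw [← (glueEquiv F hv).sum_comp, Fintype.sum_prod_type]
  rfl

theorem prod_coe_insert (hv : v ∉ T) {M : Type*} [CommMonoid M] (φ : ↥(insert v T) → M) :
    ∏ x, φ x = φ ⟨v, Finset.mem_insert_self v T⟩ *
      ∏ x : T, φ ⟨x, Finset.mem_insert_of_mem x.2⟩ := by
  rw [← (Finset.subtypeInsertEquivOption hv).symm.prod_comp, Fintype.prod_option]
  rfl

end Glue

/-! ### The density matrix of a finite subtree -/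

section LeafFactor

variable {V : Type*} (G : SimpleGraph V) [G.LocallyFinite] (o : V) (θ : ℕ → ℝ) (v : V)

/-- The factor which a leaf `v` contributes to the unnormalised density matrix when its spin is
traced out. -/
def leafFactor : ℝ :=
  √(branchWeight (G.degree v - 1) (θ (G.dist o v + 1)) *
    branchWeight (G.degree v - 1) (-θ (G.dist o v + 1)))

variable {G o θ v} in
theorem leafFactor_pos : 0 < leafFactor G o θ v :=
  Real.sqrt_pos.mpr (mul_pos (branchWeight_pos _ _) (branchWeight_pos _ _))

variable {G o θ} in
theorem prod_leafFactor_ne_zero (D : Finset V) :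
    ((∏ v ∈ D, leafFactor G o θ v : ℝ) : ℂ) ≠ 0 :=
  Complex.ofReal_ne_zero.mpr (Finset.prod_pos fun _ _ => leafFactor_pos).ne'

end LeafFactor

section Net

variable {V : Type*} [DecidableEq V] (G : SimpleGraph V) (o : V)

/-- The states of the legs at `x`, that is, of the spins 1/2 which `x` is composed of. -/
abbrev LegState (x : V) : Type _ := G.neighborSet x → Bool

/-- The states of the legs at the vertices of `T`. -/
abbrev Legs (T : Finset V) : Type _ := (x : T) → LegState G (x : V)

variable {G}

open scoped Classical in
/-- The state of the leg at `x` on the edge `xy`, with a junk value if there is no such leg. -/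
def leg {T : Finset V} (s : Legs G T) (x y : V) : Bool :=
  if h : x ∈ T ∧ G.Adj x y then s ⟨x, h.1⟩ ⟨y, h.2⟩ else false

theorem leg_of_mem {T : Finset V} (s : Legs G T) {x y : V} (hx : x ∈ T) (h : G.Adj x y) :
    leg s x y = s ⟨x, hx⟩ ⟨y, h⟩ := by
  rw [leg, dif_pos ⟨hx, h⟩]

theorem leg_glue_of_mem {T : Finset V} {v : V} (hv : v ∉ T) (a : LegState G v) (s : Legs G T)
    {x : V} (hx : x ∈ T) (y : V) : leg (glue (LegState G) a s) x y = leg s x y := by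
  by_cases h : G.Adj x y
  · rw [leg_of_mem _ (Finset.mem_insert_of_mem hx) h, leg_of_mem _ hx h, glue_of_mem _ hv _ _ hx]
  · rw [leg, dif_neg fun h' => h h'.2, leg, dif_neg fun h' => h h'.2]

theorem leg_glue_self {T : Finset V} {v : V} (a : LegState G v) (s : Legs G T) {y : V}
    (h : G.Adj v y) : leg (glue (LegState G) a s) v y = a ⟨y, h⟩ := by
  rw [leg_of_mem _ (Finset.mem_insert_self _ _) h, glue_self]

variable (G)

/-- The factor of the edge from `x` to its child `y` in the density matrix of `T`, for the leg
states `s` of the ket and `s'` of the bra: a singlet if `y ∈ T`, a diagonal boundary weight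
otherwise. -/
def bond (θ : ℕ → ℝ) {T : Finset V} (s s' : Legs G T) (x y : V) : ℂ :=
  if y ∈ T then singlet (leg s x y) (leg s y x) * singlet (leg s' x y) (leg s' y x)
  else if leg s x y = leg s' x y then legWeight (θ (G.dist o y)) (leg s x y) else 0

variable {G o} {θ : ℕ → ℝ} {T : Finset V} {p v : V}

theorem bond_glue_parent (hv : v ∉ T) (hp : p ∈ T) (hpv : IsChild G o p v) (a a' : LegState G v)
    (s s' : Legs G T) :
    bond G o θ (glue (LegState G) a s) (glue (LegState G) a' s') p v =
      singlet (leg s p v) (a ⟨p, hpv.1.symm⟩) * singlet (leg s' p v) (a' ⟨p, hpv.1.symm⟩) := by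
  rw [bond, if_pos (Finset.mem_insert_self _ _), leg_glue_of_mem hv _ _ hp,
    leg_glue_of_mem hv _ _ hp, leg_glue_self _ _ hpv.1.symm, leg_glue_self _ _ hpv.1.symm]

theorem bond_glue_of_ne (hv : v ∉ T) (a a' : LegState G v) (s s' : Legs G T) {x y : V}
    (hx : x ∈ T) (hy : y ≠ v) :
    bond G o θ (glue (LegState G) a s) (glue (LegState G) a' s') x y = bond G o θ s s' x y := by
  rw [bond, bond, leg_glue_of_mem hv _ _ hx, leg_glue_of_mem hv _ _ hx]
  by_cases hyT : y ∈ T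
  · rw [if_pos (Finset.mem_insert_of_mem hyT), if_pos hyT, leg_glue_of_mem hv _ _ hyT,
      leg_glue_of_mem hv _ _ hyT]
  · rw [if_neg (by simp [hy, hyT]), if_neg hyT]

variable (G) [G.LocallyFinite]

/-- The labels of the basis of the spin `deg x / 2` at `x`. -/
abbrev SpinLabel (x : V) : Type := Fin (G.degree x + 1)

variable {G}

/-- The overlap of the basis vector `k` of `⨂_{x ∈ T} ℂ^(deg x + 1)` with the product state of the
legs labelled by `s`. -/
def legAmplitude {T : Finset V} (k : Config G T) (s : Legs G T) : ℂ :=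
  ∏ x : T, symAmplitude (k x : ℕ) (s x)

theorem legAmplitude_glue {T : Finset V} {v : V} (hv : v ∉ T) (e : SpinLabel G v)
    (k : Config G T) (a : LegState G v) (s : Legs G T) :
    legAmplitude (glue (SpinLabel G) e k) (glue (LegState G) a s) =
      symAmplitude (e : ℕ) a * legAmplitude k s := by
  rw [legAmplitude, prod_coe_insert hv]
  simp only [glue_self, glue_of_mem _ hv _ _ (Subtype.prop _)]
  rfl

variable (G o θ T)

/-- The unnormalised density matrix of the valence bond solid on `T` with the product boundary
condition that puts the field `θ i` on the legs leaving `T` towards a vertex of the layer `i`. -/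
def netState : Observable G T :=
  Matrix.of fun k l => ∑ s : Legs G T, ∑ s' : Legs G T,
    legAmplitude k s * legAmplitude l s' * ∏ x ∈ T, ∏ y ∈ children G o x, bond G o θ s s' x y

variable {G o θ T}

theorem prod_bond_glue_children (hG : G.IsTree) (hpv : IsChild G o p v)
    (hch : ∀ y, IsChild G o v y → y ∉ T) (a a' : LegState G v) (s s' : Legs G T) :
    ∏ y ∈ children G o v, bond G o θ (glue (LegState G) a s) (glue (LegState G) a' s') v y =
      ∏ i ∈ Finset.univ.erase ⟨p, hpv.1.symm⟩,
        if a i = a' i then legWeight (θ (G.dist o v + 1)) (a i) else 0 := by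
  rw [children_eq_map_erase hG hpv, Finset.prod_map]
  refine Finset.prod_congr rfl fun i hi => ?_
  have hvi : IsChild G o v i := by
    rw [← mem_children, children_eq_map_erase hG hpv]
    exact Finset.mem_map_of_mem (Function.Embedding.subtype _) hi
  have hiT : (i : V) ∉ insert v T := by
    rw [Finset.mem_insert, not_or]
    exact ⟨hvi.1.ne', hch _ hvi⟩
  rw [Function.Embedding.coe_subtype, bond, if_neg hiT, leg_glue_self _ _ hvi.1,
    leg_glue_self _ _ hvi.1]
  simp only [hvi.2]

theorem prod_bond_glue (hG : G.IsTree) (hv : v ∉ T) (hp : p ∈ T) (hpv : IsChild G o p v)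
    (hch : ∀ y, IsChild G o v y → y ∉ T) (a a' : LegState G v) (s s' : Legs G T) :
    ∏ x ∈ insert v T, ∏ y ∈ children G o x,
        bond G o θ (glue (LegState G) a s) (glue (LegState G) a' s') x y =
      singlet (leg s p v) (a ⟨p, hpv.1.symm⟩) * singlet (leg s' p v) (a' ⟨p, hpv.1.symm⟩) *
        (∏ i ∈ Finset.univ.erase ⟨p, hpv.1.symm⟩,
          if a i = a' i then legWeight (θ (G.dist o v + 1)) (a i) else 0) *
        ∏ x ∈ T, ∏ y ∈ (children G o x).erase v, bond G o θ s s' x y := by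
  rw [Finset.prod_insert hv, prod_bond_glue_children hG hpv hch, prod_children_eq_mul hG hp hpv,
    bond_glue_parent hv hp hpv]
  have hrest : ∏ x ∈ T, ∏ y ∈ (children G o x).erase v,
      bond G o θ (glue (LegState G) a s) (glue (LegState G) a' s') x y =
      ∏ x ∈ T, ∏ y ∈ (children G o x).erase v, bond G o θ s s' x y :=
    Finset.prod_congr rfl fun x hx => Finset.prod_congr rfl fun y hy =>
      bond_glue_of_ne hv _ _ _ _ hx (Finset.ne_of_mem_erase hy)
  rw [hrest]
  ring

theorem sum_leg_vertex (hpv : IsChild G o p v)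
    (hθ : θ (G.dist o v) = -branchField (G.degree v - 1) (θ (G.dist o v + 1))) (c c' : Bool) :
    ∑ e : SpinLabel G v, ∑ a : LegState G v, ∑ a' : LegState G v,
      symAmplitude (e : ℕ) a * symAmplitude (e : ℕ) a' *
        (singlet c (a ⟨p, hpv.1.symm⟩) * singlet c' (a' ⟨p, hpv.1.symm⟩)) *
        ∏ i ∈ Finset.univ.erase ⟨p, hpv.1.symm⟩,
          (if a i = a' i then legWeight (θ (G.dist o v + 1)) (a i) else 0) =
      leafFactor G o θ v * if c = c' then legWeight (θ (G.dist o v)) c else 0 := by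
  have hdeg : Fintype.card (G.neighborSet v) = G.degree v - 1 + 1 := by
    rw [G.card_neighborSet_eq_degree,
      Nat.sub_add_cancel ((G.degree_pos_iff_exists_adj v).mpr ⟨p, hpv.1.symm⟩)]
  rw [hθ, leafFactor, ← sum_vertex hdeg, G.card_neighborSet_eq_degree, Finset.sum_range]

theorem sum_netState_glue (hG : G.IsTree) (hv : v ∉ T) (hp : p ∈ T) (hpv : IsChild G o p v)
    (hch : ∀ y, IsChild G o v y → y ∉ T)
    (hθ : θ (G.dist o v) = -branchField (G.degree v - 1) (θ (G.dist o v + 1)))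
    (k l : Config G T) :
    ∑ e : SpinLabel G v,
      netState G o θ (insert v T) (glue (SpinLabel G) e k) (glue (SpinLabel G) e l) =
    leafFactor G o θ v * netState G o θ T k l := by
  have hsum (Φ : Legs G (insert v T) → Legs G (insert v T) → ℂ) :
      ∑ s, ∑ s', Φ s s' = ∑ s : Legs G T, ∑ s' : Legs G T, ∑ a : LegState G v,
        ∑ a' : LegState G v, Φ (glue (LegState G) a s) (glue (LegState G) a' s') := by
    simp only [sum_glue (LegState G) hv]
    exact Finset.sum_congr rfl fun s _ => Finset.sum_comm
  simp only [netState, Matrix.of_apply]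
  calc _ = ∑ s : Legs G T, ∑ s' : Legs G T, legAmplitude k s * legAmplitude l s' *
        (∏ x ∈ T, ∏ y ∈ (children G o x).erase v, bond G o θ s s' x y) *
        ∑ e : SpinLabel G v, ∑ a : LegState G v, ∑ a' : LegState G v,
          symAmplitude (e : ℕ) a * symAmplitude (e : ℕ) a' *
          (singlet (leg s p v) (a ⟨p, hpv.1.symm⟩) * singlet (leg s' p v) (a' ⟨p, hpv.1.symm⟩)) *
          ∏ i ∈ Finset.univ.erase ⟨p, hpv.1.symm⟩,
            (if a i = a' i then legWeight (θ (G.dist o v + 1)) (a i) else 0) := by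
        rw [Finset.sum_congr rfl fun e _ => hsum _, Finset.sum_comm]
        refine Finset.sum_congr rfl fun s _ => ?_
        rw [Finset.sum_comm]
        refine Finset.sum_congr rfl fun s' _ => ?_
        simp only [Finset.mul_sum, legAmplitude_glue hv, prod_bond_glue hG hv hp hpv hch]
        refine Finset.sum_congr rfl fun e _ => Finset.sum_congr rfl fun a _ =>
          Finset.sum_congr rfl fun a' _ => ?_
        ring
    _ = _ := by
        simp only [sum_leg_vertex hpv hθ, prod_children_eq_mul hG hp hpv, bond, if_neg hv,
          Finset.mul_sum]
        refine Finset.sum_congr rfl fun s _ => Finset.sum_congr rfl fun s' _ => ?_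
        ring

theorem restrict_glue {S : Finset V} (h : S ⊆ T) (hv : v ∉ T) (e : SpinLabel G v)
    (k : Config G T) :
    restrict G (h.trans (Finset.subset_insert v T)) (glue (SpinLabel G) e k) = restrict G h k :=
  funext fun x => glue_of_mem (SpinLabel G) hv _ _ (h x.2) _

theorem extend_glue {S : Finset V} (h : S ⊆ T) (hv : v ∉ T) (A : Observable G S)
    (e e' : SpinLabel G v) (k l : Config G T) :
    extend G (h.trans (Finset.subset_insert v T)) A
      (glue (SpinLabel G) e k) (glue (SpinLabel G) e' l) =
    if e = e' then extend G h A k l else 0 := by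
  simp only [extend, Matrix.of_apply, restrict_glue h hv, ← ite_and]
  refine if_congr ⟨fun H => ⟨?_, fun y hy => ?_⟩, fun ⟨he, H⟩ y hy => ?_⟩ rfl rfl
  · simpa only [glue_self] using H ⟨v, Finset.mem_insert_self v T⟩ fun hS => hv (h hS)
  · simpa only [glue_of_mem _ hv _ _ y.2] using H ⟨y, Finset.mem_insert_of_mem y.2⟩ hy
  · obtain ⟨y, hyT⟩ := y
    rcases Finset.mem_insert.mp hyT with rfl | hyT'
    · rw [glue_self, glue_self, he]
    · rw [glue_of_mem _ hv _ _ hyT', glue_of_mem _ hv _ _ hyT']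
      exact H ⟨y, hyT'⟩ hy

theorem trace_netState_insert (hG : G.IsTree) (hv : v ∉ T) (hp : p ∈ T) (hpv : IsChild G o p v)
    (hch : ∀ y, IsChild G o v y → y ∉ T)
    (hθ : θ (G.dist o v) = -branchField (G.degree v - 1) (θ (G.dist o v + 1)))
    {S : Finset V} (h : S ⊆ T) (A : Observable G S) :
    (netState G o θ (insert v T) * extend G (h.trans (Finset.subset_insert v T)) A).trace =
      leafFactor G o θ v * (netState G o θ T * extend G h A).trace := by
  simp only [Matrix.trace, Matrix.diag_apply, Matrix.mul_apply]
  rw [sum_glue (SpinLabel G) hv, Finset.mul_sum]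
  refine Finset.sum_congr rfl fun k _ => ?_
  simp only [sum_glue (SpinLabel G) hv]
  rw [Finset.sum_comm, Finset.mul_sum]
  refine Finset.sum_congr rfl fun l _ => ?_
  simp only [extend_glue h hv, mul_ite, mul_zero, Finset.sum_ite_eq', Finset.mem_univ, if_true]
  rw [← Finset.sum_mul, sum_netState_glue hG hv hp hpv hch hθ, mul_assoc]

end Net

/-! ### Product boundary conditions -/

theorem star_symAmplitude {ι : Type*} [Fintype ι] (k : ℕ) (s : ι → Bool) :
    star (symAmplitude k s) = symAmplitude k s := by
  simp only [symAmplitude, apply_ite star, star_zero, Complex.star_def, Complex.conj_ofReal]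

theorem star_singlet (a b : Bool) : star (singlet a b) = singlet a b := by
  cases a <;> cases b <;> simp [singlet]

section Parent

variable {V : Type*} (G : SimpleGraph V) (o v : V)

open scoped Classical in
/-- The parent of `v`, with the junk value `v` if there is none. -/
def parent : V := if h : ∃ x, IsChild G o x v then h.choose else v

variable {G o v}

theorem isChild_parent (hG : G.Connected) {n : ℕ} (hv : G.dist o v = n + 1) :
    IsChild G o (parent G o v) v := by
  obtain ⟨x, hx, -⟩ := exists_isChild hG hv
  have h : ∃ x, IsChild G o x v := ⟨x, hx⟩
  rw [parent, dif_pos h]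
  exact h.choose_spec

theorem IsChild.parent_eq (hG : G.IsTree) {x : V} (h : IsChild G o x v) : parent G o v = x :=
  (isChild_parent hG.connected h.2).parent_unique hG h

end Parent

section ProductBoundary

variable {V : Type*} [DecidableEq V] {G : SimpleGraph V} [G.LocallyFinite] {o : V} {n : ℕ}

theorem parent_mem_ball (hG : G.Connected) {v : V} (hv : v ∈ boundary G o n) :
    parent G o v ∈ ball G o n := by
  rw [mem_boundary G o hG] at hv
  have := (isChild_parent hG hv).2
  rw [mem_ball G o hG]
  omega

theorem filter_parent_eq (hG : G.IsTree) {x : V} (hx : x ∈ ball G o n) :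
    (boundary G o n).filter (fun v => parent G o v = x) =
      (children G o x).filter fun v => v ∉ ball G o n := by
  ext v
  simp only [Finset.mem_filter, mem_children, mem_boundary G o hG.connected,
    mem_ball G o hG.connected] at hx ⊢
  constructor
  · rintro ⟨hv, rfl⟩
    exact ⟨isChild_parent hG.connected hv, by omega⟩
  · rintro ⟨hxv, hv⟩
    have := hxv.2
    exact ⟨by omega, hxv.parent_eq hG⟩

theorem prod_boundary {M : Type*} [CommMonoid M] (hG : G.IsTree) (φ : V → V → M) :
    ∏ v : boundary G o n, φ (parent G o v) v =
      ∏ x ∈ ball G o n, ∏ y ∈ children G o x, if y ∈ ball G o n then 1 else φ x y := by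
  rw [Finset.prod_coe_sort (boundary G o n) fun v => φ (parent G o v) v,
    ← Finset.prod_fiberwise_of_maps_to fun v hv => parent_mem_ball hG.connected hv]
  refine Finset.prod_congr rfl fun x hx => ?_
  calc ∏ v ∈ (boundary G o n).filter (fun v => parent G o v = x), φ (parent G o v) v
      = ∏ v ∈ (boundary G o n).filter (fun v => parent G o v = x), φ x v :=
        Finset.prod_congr rfl fun v hv => by rw [(Finset.mem_filter.mp hv).2]
    _ = ∏ y ∈ children G o x, if y ∈ ball G o n then 1 else φ x y := by
        simp only [filter_parent_eq hG hx, Finset.prod_filter, ite_not]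

variable (G o) in
/-- The coefficient of the product state of the legs labelled by `s` in the product of the singlets
on the edges inside `T`. -/
def singletProduct {T : Finset V} (s : Legs G T) : ℂ :=
  ∏ x ∈ T, ∏ y ∈ children G o x, if y ∈ T then singlet (leg s x y) (leg s y x) else 1

/-- The states of the legs leaving `T_n`. -/
def boundaryLegs (s : Legs G (ball G o n)) : BoundaryConfig G o n :=
  fun v => leg s (parent G o v) v

theorem eq_boundaryLegs_iff (hG : G.IsTree) (s : Legs G (ball G o n)) (b : BoundaryConfig G o n) :
    b = boundaryLegs s ↔ ∀ (x : ball G o n) (v : boundary G o n) (h : G.Adj (x : V) (v : V)),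
      s x ⟨(v : V), h⟩ = b v := by
  constructor
  · rintro rfl x v h
    have hx := (mem_ball G o hG.connected n x).mp x.2
    have hv := (mem_boundary G o hG.connected n v).mp v.2
    have hxv : IsChild G o x v := (isChild_or_isChild hG h).resolve_right fun h' => by
      have := h'.2
      omega
    rw [boundaryLegs, hxv.parent_eq hG, leg_of_mem _ x.2 h]
  · intro H
    funext v
    have hv := (isChild_parent hG.connected ((mem_boundary G o hG.connected n v).mp v.2)).1
    rw [boundaryLegs, leg_of_mem _ (parent_mem_ball hG.connected v.2) hv,
      H ⟨_, parent_mem_ball hG.connected v.2⟩ v hv]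

open scoped Classical in
theorem singletProduct_eq {T : Finset V} (s : Legs G T) :
    singletProduct G o s = ∏ x : T, ∏ y : T,
      if h : IsChild G o (x : V) (y : V) then
        singlet (s x ⟨(y : V), h.1⟩) (s y ⟨(x : V), h.1.symm⟩)
      else 1 := by
  rw [singletProduct, ← Finset.prod_coe_sort T]
  refine Finset.prod_congr rfl fun x _ => ?_
  rw [← Finset.prod_filter, Finset.filter_mem_eq_inter, Finset.inter_comm,
    ← Finset.filter_mem_eq_inter, Finset.prod_filter, ← Finset.prod_coe_sort T]
  refine Finset.prod_congr rfl fun y _ => ?_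
  by_cases h : IsChild G o (x : V) (y : V)
  · rw [dif_pos h, if_pos (mem_children.mpr h), leg_of_mem _ x.2 h.1, leg_of_mem _ y.2 h.1.symm]
  · rw [dif_neg h, if_neg (mem_children.not.mpr h)]

theorem vbs_apply (hG : G.IsTree) (k : Config G (ball G o n)) (b : BoundaryConfig G o n) :
    vbs G o n k b = ∑ s : Legs G (ball G o n), legAmplitude k s * singletProduct G o s *
      if b = boundaryLegs s then 1 else 0 := by
  rw [vbs, Matrix.of_apply]
  refine Finset.sum_congr rfl fun s _ => ?_
  rw [singletProduct_eq, legAmplitude]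
  classical
  congr 1
  exact if_congr (eq_boundaryLegs_iff hG s b).symm rfl rfl

theorem star_vbs (hG : G.IsTree) (k : Config G (ball G o n)) (b : BoundaryConfig G o n) :
    star (vbs G o n k b) = vbs G o n k b := by
  simp only [vbs_apply hG, legAmplitude, singletProduct, star_sum, star_mul', star_prod,
    star_symAmplitude, apply_ite star, star_one, star_zero, star_singlet]

variable (G o) in
/-- The product boundary condition with the weights `e^(θ i)`, `e^(-θ i)` on each boundary spin,
where `i` is the layer of the boundary. -/
def productBoundary (θ : ℕ → ℝ) (n : ℕ) : BoundaryMatrix G o n :=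
  Matrix.diagonal fun b => ∏ v : boundary G o n, legWeight (θ (G.dist o v)) (b v)

theorem posSemidef_productBoundary (θ : ℕ → ℝ) (n : ℕ) :
    (productBoundary G o θ n).PosSemidef := by
  refine Matrix.PosSemidef.diagonal fun b => ?_
  simp only [legWeight, ← Complex.ofReal_prod]
  rw [Pi.zero_apply, Complex.zero_le_real]
  exact Finset.prod_nonneg fun v _ => (Real.exp_pos _).le

variable {θ : ℕ → ℝ}

theorem sum_boundaryLegs (hG : G.IsTree) (s s' : Legs G (ball G o n)) :
    ∑ b : BoundaryConfig G o n, (if b = boundaryLegs s' then 1 else 0) *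
        (∏ v : boundary G o n, legWeight (θ (G.dist o v)) (b v)) *
        (if b = boundaryLegs s then 1 else 0) =
      ∏ x ∈ ball G o n, ∏ y ∈ children G o x, if y ∈ ball G o n then 1 else
        if leg s x y = leg s' x y then legWeight (θ (G.dist o y)) (leg s x y) else 0 := by
  rw [← prod_boundary hG fun x y =>
    if leg s x y = leg s' x y then legWeight (θ (G.dist o y)) (leg s x y) else 0,
    Finset.prod_ite_zero]
  simp only [ite_mul, one_mul, zero_mul, Finset.sum_ite_eq', Finset.mem_univ, if_true, mul_ite,
    mul_one, mul_zero]
  exact if_congr (by simp only [funext_iff, forall_const, boundaryLegs]) rfl rfl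

theorem prod_bond_eq {T : Finset V} (s s' : Legs G T) :
    ∏ x ∈ T, ∏ y ∈ children G o x, bond G o θ s s' x y =
      singletProduct G o s * singletProduct G o s' *
      ∏ x ∈ T, ∏ y ∈ children G o x, if y ∈ T then 1 else
        if leg s x y = leg s' x y then legWeight (θ (G.dist o y)) (leg s x y) else 0 := by
  simp only [singletProduct, ← Finset.prod_mul_distrib]
  refine Finset.prod_congr rfl fun x _ => Finset.prod_congr rfl fun y _ => ?_
  by_cases hy : y ∈ T
  · simp only [bond, if_pos hy, mul_one]
  · simp only [bond, if_neg hy, one_mul]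

theorem density_productBoundary (hG : G.IsTree) (θ : ℕ → ℝ) (n : ℕ) :
    density G o n (productBoundary G o θ n) = netState G o θ (ball G o n) := by
  ext k l
  calc density G o n (productBoundary G o θ n) k l
      = ∑ b : BoundaryConfig G o n, vbs G o n k b *
          (∏ v : boundary G o n, legWeight (θ (G.dist o v)) (b v)) * vbs G o n l b := by
        simp only [density, productBoundary, Matrix.mul_apply (M := _ * _), Matrix.mul_diagonal,
          Matrix.conjTranspose_apply, star_vbs hG]
    _ = ∑ s : Legs G (ball G o n), ∑ s' : Legs G (ball G o n), legAmplitude k s *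
          legAmplitude l s' * (singletProduct G o s * singletProduct G o s' *
          ∑ b : BoundaryConfig G o n, (if b = boundaryLegs s' then 1 else 0) *
            (∏ v : boundary G o n, legWeight (θ (G.dist o v)) (b v)) *
            (if b = boundaryLegs s then 1 else 0)) := by
        simp only [vbs_apply hG, Finset.sum_mul, Finset.mul_sum]
        rw [Finset.sum_comm]
        simp only [Finset.sum_comm (s := (Finset.univ : Finset (BoundaryConfig G o n)))]
        rw [Finset.sum_comm]
        refine Finset.sum_congr rfl fun s _ => Finset.sum_congr rfl fun s' _ =>
          Finset.sum_congr rfl fun b _ => ?_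
        ring
    _ = netState G o θ (ball G o n) k l := by
        simp only [netState, Matrix.of_apply, prod_bond_eq, sum_boundaryLegs hG]

end ProductBoundary

/-! ### Compatibility of the states on consecutive balls -/

section Consistency

variable {V : Type*} (G : SimpleGraph V) [G.LocallyFinite] (o : V) (θ : ℕ → ℝ)

/-- The fields `θ` on the layers are consistent if the field on the leg above each vertex is the one
induced by the fields on the legs below it. The sign comes from the singlet on the edge. -/
def IsConsistent : Prop :=
  ∀ v, v ≠ o → θ (G.dist o v) = -branchField (G.degree v - 1) (θ (G.dist o v + 1))

variable {G o θ}

theorem IsConsistent.neg (hθ : IsConsistent G o θ) : IsConsistent G o (-θ) := fun v hv => by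
  rw [Pi.neg_apply, Pi.neg_apply, branchField_neg, hθ v hv]

variable [DecidableEq V] {S T : Finset V} {n : ℕ}

theorem extend_self (A : Observable G S) : extend G subset_rfl A = A := by
  ext k l
  rw [extend, Matrix.of_apply, if_pos fun y hy => absurd y.2 hy]
  rfl

theorem extend_one (h : S ⊆ T) : extend G h (1 : Observable G S) = 1 := by
  ext k l
  rw [extend, Matrix.of_apply]
  rcases eq_or_ne k l with rfl | hkl
  · simp only [implies_true, if_true, Matrix.one_apply_eq]
  · rw [Matrix.one_apply_ne hkl]
    refine ite_eq_right_iff.mpr fun h_off => Matrix.one_apply_ne fun h_on =>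
      hkl (funext fun x => ?_)
    by_cases hx : (x : V) ∈ S
    · exact congrFun h_on ⟨x, hx⟩
    · exact h_off x hx

theorem trace_netState_union_ball (hG : G.IsTree) (hθ : IsConsistent G o θ) {D : Finset V}
    (hD : D ⊆ boundary G o n) (hT : T = D ∪ ball G o n) (h : S ⊆ ball G o n) (h' : S ⊆ T)
    (A : Observable G S) :
    (netState G o θ T * extend G h' A).trace =
      (∏ v ∈ D, leafFactor G o θ v : ℝ) * (netState G o θ (ball G o n) * extend G h A).trace := by
  induction D using Finset.induction_on generalizing T with
  | empty =>
    rw [Finset.empty_union] at hT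
    subst hT
    simp
  | insert v D hvD ih =>
    have hv := (mem_boundary G o hG.connected n v).mp (hD (Finset.mem_insert_self v D))
    obtain ⟨p, hpv, hpn⟩ := exists_isChild hG.connected hv
    have hmem {y : V} (hy : y ∈ D ∪ ball G o n) : G.dist o y ≤ n + 1 := by
      rcases Finset.mem_union.mp hy with hy | hy
      · exact ((mem_boundary G o hG.connected n y).mp (hD (Finset.mem_insert_of_mem hy))).le
      · exact ((mem_ball G o hG.connected n y).mp hy).trans n.le_succ
    have hvT : v ∉ D ∪ ball G o n := by
      rw [Finset.mem_union, mem_ball G o hG.connected, not_or]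
      exact ⟨hvD, by omega⟩
    have hch (y : V) (hy : IsChild G o v y) : y ∉ D ∪ ball G o n := fun hyT => by
      have := hmem hyT
      have := hy.2
      omega
    have hp : p ∈ D ∪ ball G o n :=
      Finset.mem_union_right _ ((mem_ball G o hG.connected n p).mpr hpn.le)
    have hvo : v ≠ o := by
      rintro rfl
      simp at hv
    obtain rfl : T = insert v (D ∪ ball G o n) := hT.trans (Finset.insert_union ..)
    rw [trace_netState_insert hG hvT hp hpv hch (hθ v hvo) (h.trans Finset.subset_union_right),
      ih ((Finset.subset_insert v D).trans hD) rfl, Finset.prod_insert hvD, Complex.ofReal_mul,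
      mul_assoc]

theorem trace_netState_ball_succ (hG : G.IsTree) (hθ : IsConsistent G o θ) (h : S ⊆ ball G o n)
    (h' : S ⊆ ball G o (n + 1)) (A : Observable G S) :
    (netState G o θ (ball G o (n + 1)) * extend G h' A).trace =
      (∏ v ∈ boundary G o n, leafFactor G o θ v : ℝ) *
        (netState G o θ (ball G o n) * extend G h A).trace :=
  trace_netState_union_ball hG hθ subset_rfl
    (Finset.sdiff_union_of_subset (ball_mono hG.connected n.le_succ)).symm h h' A

theorem trace_netState_ball_succ_one (hG : G.IsTree) (hθ : IsConsistent G o θ) :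
    (netState G o θ (ball G o (n + 1))).trace =
      (∏ v ∈ boundary G o n, leafFactor G o θ v : ℝ) * (netState G o θ (ball G o n)).trace := by
  simpa only [extend_one, mul_one] using
    trace_netState_ball_succ hG hθ subset_rfl (ball_mono hG.connected n.le_succ) 1

theorem expectation_succ (hG : G.IsTree) (hθ : IsConsistent G o θ) (h : S ⊆ ball G o n)
    (A : Observable G S) :
    expectation G o (n + 1) (productBoundary G o θ (n + 1)) S A =
      expectation G o n (productBoundary G o θ n) S A := by
  have h' := h.trans (ball_mono hG.connected n.le_succ)
  rw [expectation, expectation, dif_pos h, dif_pos h', density_productBoundary hG,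
    density_productBoundary hG, trace_netState_ball_succ hG hθ h h',
    trace_netState_ball_succ_one hG hθ, mul_div_mul_left _ _ (prod_leafFactor_ne_zero _)]

theorem root_mem_ball_zero : o ∈ ball G o 0 := Finset.mem_singleton_self o

abbrev uniqueBallZero : Unique (ball G o 0) :=
  ⟨⟨⟨o, root_mem_ball_zero⟩⟩, fun x => Subtype.ext (Finset.mem_singleton.mp x.2)⟩

theorem prod_bond_ball_zero (s s' : Legs G (ball G o 0)) :
    ∏ x ∈ ball G o 0, ∏ y ∈ children G o x, bond G o θ s s' x y =
      ∏ y : G.neighborSet o, if s ⟨o, root_mem_ball_zero⟩ y = s' ⟨o, root_mem_ball_zero⟩ y then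
        legWeight (θ 1) (s ⟨o, root_mem_ball_zero⟩ y) else 0 := by
  refine (Finset.prod_singleton _ _).trans ?_
  rw [Finset.prod_subtype (p := (· ∈ G.neighborSet o)) _
    fun y => mem_children_self]
  refine Finset.prod_congr rfl fun y _ => ?_
  have hy : G.Adj o y := y.2
  have hy_notMem : (y : V) ∉ ball G o 0 := Finset.notMem_singleton.mpr hy.ne'
  rw [bond, if_neg hy_notMem, leg_of_mem _ root_mem_ball_zero hy,
    leg_of_mem _ root_mem_ball_zero hy, SimpleGraph.dist_eq_one_iff_adj.mpr hy]

theorem netState_root_diag (θ : ℕ → ℝ) (k : Config G (ball G o 0)) :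
    netState G o θ (ball G o 0) k k =
      (Real.exp ((2 * (k ⟨o, root_mem_ball_zero⟩ : ℕ) - G.degree o) * θ 1) : ℝ) := by
  let : Unique (ball G o 0) := uniqueBallZero
  let legEquiv : Legs G (ball G o 0) ≃ LegState G o :=
    Equiv.piUnique fun x : ball G o 0 => LegState G (x : V)
  set m : ℕ := (k ⟨o, root_mem_ball_zero⟩ : ℕ)
  have hm : m ≤ Fintype.card (G.neighborSet o) := by
    rw [G.card_neighborSet_eq_degree]
    exact Nat.lt_succ_iff.mp (k ⟨o, root_mem_ball_zero⟩).2
  have hsum : netState G o θ (ball G o 0) k k = ∑ t : LegState G o, ∑ t' : LegState G o,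
      symAmplitude m t * symAmplitude m t' *
        ∏ y, if t y = t' y then legWeight (θ 1) (t y) else 0 := by
    simp only [netState, Matrix.of_apply, prod_bond_ball_zero, legAmplitude, Fintype.prod_unique]
    exact Fintype.sum_equiv legEquiv _ _ fun s => Fintype.sum_equiv legEquiv _ _ fun s' => rfl
  rw [hsum, sum_symAmplitude_mul_self_mul_prod_legWeight hm, G.card_neighborSet_eq_degree]

theorem trace_density_ne_zero (hG : G.IsTree) (hθ : IsConsistent G o θ) (n : ℕ) :
    (density G o n (productBoundary G o θ n)).trace ≠ 0 := by
  rw [density_productBoundary hG]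
  induction n with
  | zero =>
    simp only [Matrix.trace, Matrix.diag_apply, netState_root_diag, ← Complex.ofReal_sum]
    rw [Complex.ofReal_ne_zero]
    exact (Finset.sum_pos (fun k _ => Real.exp_pos _) ⟨fun _ => 0, Finset.mem_univ _⟩).ne'
  | succ n ih =>
    rw [trace_netState_ball_succ_one hG hθ]
    exact mul_ne_zero (prod_leafFactor_ne_zero _) ih

end Consistency

/-! ### Vectors of maximal total spin -/

section Ladder

/-- The norm `√(d choose i)` of the sum of all product states of `d` spins 1/2 with `i` ups.
Dividing by it turns the matrix entries of the ladder operators into integers. -/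
def symNorm (d i : ℕ) : ℂ := (√(d.choose i) : ℝ)

theorem symNorm_ne_zero {d i : ℕ} (h : i ≤ d) : symNorm d i ≠ 0 := by
  rw [symNorm, Complex.ofReal_ne_zero, Real.sqrt_ne_zero']
  exact_mod_cast Nat.choose_pos h

theorem sqrt_mul_symNorm {d i : ℕ} (h : i < d) :
    (√(((d : ℝ) - i) * (i + 1)) : ℂ) * symNorm d i = (i + 1) * symNorm d (i + 1) := by
  have hchoose : ((d : ℝ) - i) * (i + 1) * d.choose i = (i + 1) ^ 2 * d.choose (i + 1) := by
    have hsucc : (d.choose (i + 1) : ℝ) * (i + 1) = d.choose i * (d - i : ℕ) := by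
      exact_mod_cast Nat.choose_succ_right_eq d i
    rw [Nat.cast_sub h.le] at hsucc
    linear_combination (-((i : ℝ) + 1)) * hsucc
  rw [symNorm, symNorm, ← Complex.ofReal_mul, ← Real.sqrt_mul' _ (by positivity), hchoose,
    Real.sqrt_mul (by positivity), Real.sqrt_sq (by positivity)]
  push_cast
  rfl

theorem sqrt_mul_symNorm_succ {d i : ℕ} (h : i < d) :
    (√(((d : ℝ) - i) * (i + 1)) : ℂ) * symNorm d (i + 1) = (d - i) * symNorm d i := by
  refine mul_left_cancel₀ (show (i : ℂ) + 1 ≠ 0 by exact_mod_cast i.succ_ne_zero) ?_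
  rw [mul_left_comm, ← sqrt_mul_symNorm h, ← mul_assoc, ← Complex.ofReal_mul,
    Real.mul_self_sqrt (mul_nonneg (sub_nonneg.mpr (by exact_mod_cast h.le)) (by positivity))]
  push_cast
  ring

theorem exists_eq_symNorm_mul {d : ℕ} (u : Fin (d + 1) → ℂ) :
    ∃ g : ℕ → ℂ, u = fun i : Fin (d + 1) => symNorm d i * g i := by
  refine ⟨fun i => if h : i < d + 1 then u ⟨i, h⟩ / symNorm d i else 0, funext fun i => ?_⟩
  simp only [i.2, dif_pos]
  rw [mul_div_cancel₀ _ (symNorm_ne_zero i.is_le)]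

theorem spinPlus_mulVec (d : ℕ) (g : ℕ → ℂ) :
    (spinPlus d).mulVec (fun a : Fin (d + 1) => symNorm d a * g a) =
      fun i : Fin (d + 1) => symNorm d i * ((i : ℕ) * g (i - 1)) := by
  funext ⟨i, hi⟩
  rw [Matrix.mulVec, dotProduct]
  rcases i with _ | i
  · simp [spinPlus]
  rw [Finset.sum_eq_single_of_mem (⟨i, by omega⟩ : Fin (d + 1)) (Finset.mem_univ _)]
  · simp only [spinPlus, Matrix.of_apply, if_true, Nat.add_sub_cancel]
    rw [← mul_assoc, sqrt_mul_symNorm (by omega)]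
    push_cast
    ring
  · intro a _ ha
    rw [spinPlus, Matrix.of_apply, if_neg, zero_mul]
    exact fun h => ha (Fin.ext (by simpa using h.symm))

theorem spinMinus_mulVec (d : ℕ) (g : ℕ → ℂ) :
    (spinMinus d).mulVec (fun a : Fin (d + 1) => symNorm d a * g a) =
      fun i : Fin (d + 1) => symNorm d i * ((d - (i : ℕ)) * g (i + 1)) := by
  funext ⟨i, hi⟩
  simp only [Matrix.mulVec, dotProduct, spinMinus, Matrix.conjTranspose_apply, spinPlus,
    Matrix.of_apply]
  rcases (Nat.lt_succ_iff.mp hi).eq_or_lt with rfl | hid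
  · refine (Finset.sum_eq_zero fun a _ => ?_).trans (by ring)
    rw [if_neg (by omega), star_zero, zero_mul]
  · rw [Finset.sum_eq_single_of_mem (⟨i + 1, by omega⟩ : Fin (d + 1)) (Finset.mem_univ _)]
    · rw [if_pos rfl, Complex.star_def, Complex.conj_ofReal, ← mul_assoc,
        sqrt_mul_symNorm_succ hid]
      ring
    · intro a _ ha
      rw [if_neg fun h => ha (Fin.ext h), star_zero, zero_mul]

theorem spinPlus_mulVec_spinMinus_mulVec {a b : ℕ} (f : ℕ → ℕ → ℂ) (i : Fin (a + 1))
    (j : Fin (b + 1)) :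
    (spinPlus a).mulVec (fun m => (spinMinus b).mulVec
        (fun n => symNorm b n * (symNorm a m * f m n)) j) i =
      symNorm a i * symNorm b j * (i * (b - (j : ℕ)) * f (i - 1) (j + 1)) := by
  have hinner (m : Fin (a + 1)) :
      (spinMinus b).mulVec (fun n => symNorm b n * (symNorm a m * f m n)) j =
        symNorm a m * (symNorm b j * ((b - (j : ℕ)) * f m (j + 1))) :=
    (congrFun (spinMinus_mulVec b fun n => symNorm a m * f m n) j).trans (by ring)
  simp only [hinner]
  rw [spinPlus_mulVec a fun m => symNorm b j * ((b - (j : ℕ)) * f m (j + 1))]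
  ring

theorem spinMinus_mulVec_spinPlus_mulVec {a b : ℕ} (f : ℕ → ℕ → ℂ) (i : Fin (a + 1))
    (j : Fin (b + 1)) :
    (spinMinus a).mulVec (fun m => (spinPlus b).mulVec
        (fun n => symNorm b n * (symNorm a m * f m n)) j) i =
      symNorm a i * symNorm b j * (j * (a - (i : ℕ)) * f (i + 1) (j - 1)) := by
  have hinner (m : Fin (a + 1)) :
      (spinPlus b).mulVec (fun n => symNorm b n * (symNorm a m * f m n)) j =
        symNorm a m * (symNorm b j * ((j : ℕ) * f m (j - 1))) :=
    (congrFun (spinPlus_mulVec b fun n => symNorm a m * f m n) j).trans (by ring)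
  simp only [hinner]
  rw [spinMinus_mulVec a fun m => symNorm b j * ((j : ℕ) * f m (j - 1))]
  ring

theorem spin_casimir (d : ℕ) :
    (1 / 2 : ℂ) • (spinPlus d * spinMinus d + spinMinus d * spinPlus d) + spinZ d * spinZ d =
      Matrix.diagonal fun _ => (d : ℂ) / 2 * (d / 2 + 1) := by
  refine Matrix.ext_iff_mulVec.mpr fun u => ?_
  obtain ⟨g, rfl⟩ := exists_eq_symNorm_mul u
  funext i
  have hpm : (i : ℕ) * ((d - ((i : ℕ) - 1 : ℕ)) * g (i - 1 + 1)) =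
      ((i : ℕ) : ℂ) * (d - (i : ℕ) + 1) * g i := by
    rcases Nat.eq_zero_or_pos (i : ℕ) with hi | hi
    · simp [hi]
    · rw [Nat.sub_add_cancel hi, Nat.cast_sub hi]
      push_cast
      ring
  rw [Matrix.add_mulVec, Matrix.smul_mulVec, Matrix.add_mulVec, ← Matrix.mulVec_mulVec,
    ← Matrix.mulVec_mulVec, spinMinus_mulVec, spinPlus_mulVec,
    spinPlus_mulVec d fun i => (d - (i : ℂ)) * g (i + 1),
    spinMinus_mulVec d fun i => (i : ℂ) * g (i - 1), spinZ, Matrix.diagonal_mul_diagonal]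
  simp only [Pi.add_apply, Pi.smul_apply, smul_eq_mul, Matrix.mulVec_diagonal, hpm,
    Nat.add_sub_cancel]
  push_cast
  ring

theorem ladder_sum_sq {R : Type*} [Ring R] [Algebra ℂ R] {P Q Z P' Q' Z' : R}
    (hPQ : Commute P Q') (hQP : Commute Q P') (hZ : Commute Z Z') :
    ((1 / 2 : ℂ) • (P + Q) + (1 / 2 : ℂ) • (P' + Q')) ^ 2 +
        ((1 / (2 * Complex.I) : ℂ) • (P - Q) + (1 / (2 * Complex.I) : ℂ) • (P' - Q')) ^ 2 +
        (Z + Z') ^ 2 =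
      ((1 / 2 : ℂ) • (P * Q + Q * P) + Z * Z) + ((1 / 2 : ℂ) • (P' * Q' + Q' * P') + Z' * Z') +
        (P * Q' + Q * P') + (2 : ℂ) • (Z * Z') := by
  have hI : (1 / (2 * Complex.I) : ℂ) ^ 2 = -(1 / 4) := by
    rw [div_pow, mul_pow, Complex.I_sq]
    norm_num
  have hhalf : (1 / 2 : ℂ) = 1 / 4 + 1 / 4 := by norm_num
  have hladder : ((1 / 2 : ℂ) • ((P + P') + (Q + Q'))) ^ 2 +
      ((1 / (2 * Complex.I) : ℂ) • ((P + P') - (Q + Q'))) ^ 2 =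
        (1 / 2 : ℂ) • ((P + P') * (Q + Q') + (Q + Q') * (P + P')) := by
    rw [smul_pow, smul_pow, hI, show (1 / 2 : ℂ) ^ 2 = 1 / 4 by norm_num, hhalf, add_smul,
      neg_smul, ← sub_eq_add_neg, ← smul_sub, ← smul_add]
    congr 1
    noncomm_ring
  have hcross : (P + P') * (Q + Q') + (Q + Q') * (P + P') =
      (P * Q + Q * P) + (P' * Q' + Q' * P') + (2 : ℂ) • (P * Q' + Q * P') := by
    rw [two_smul]
    simp only [mul_add, add_mul, ← hPQ.eq, ← hQP.eq]
    abel
  rw [← smul_add, ← smul_add, add_add_add_comm P, sub_add_sub_comm, hladder, hcross, hZ.add_sq,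
    smul_add, smul_add, smul_smul, two_smul, sq, sq, mul_assoc, two_mul]
  norm_num
  abel

/-- The line equation expresses maximality of the total spin along the states with a fixed total
number of ups. -/
theorem apply_succ_eq_of_line_equation {a b : ℕ} {f : ℕ → ℕ → ℂ}
    (h : ∀ i ≤ a, ∀ j ≤ b, ((i : ℂ) * (b - j) + j * (a - i)) * f i j =
      i * (b - j) * f (i - 1) (j + 1) + j * (a - i) * f (i + 1) (j - 1)) :
    ∀ i < a, ∀ j < b, f (i + 1) j = f i (j + 1) := by
  have hsub : ∀ i < a, (a : ℂ) - i ≠ 0 := fun i hi => sub_ne_zero.mpr (by exact_mod_cast hi.ne')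
  have hsucc (j : ℕ) : (j : ℂ) + 1 ≠ 0 := by exact_mod_cast j.succ_ne_zero
  intro i
  induction i with
  | zero =>
    intro hi j hj
    have hline := h 0 hi.le (j + 1) hj
    simp only [Nat.cast_zero, zero_mul, zero_add, Nat.cast_add, Nat.cast_one,
      Nat.add_sub_cancel] at hline
    exact (mul_left_cancel₀ (mul_ne_zero (hsucc j) (by simpa using hsub 0 hi)) hline).symm
  | succ i ih =>
    intro hi j hj
    have hline := h (i + 1) hi.le (j + 1) hj
    have hprev : ((i : ℂ) + 1) * (b - (j + 1)) * (f (i + 1) (j + 1) - f i (j + 2)) = 0 := by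
      rcases (Nat.succ_le_of_lt hj).lt_or_eq with hjb | rfl
      · rw [ih (by omega) (j + 1) hjb, sub_self, mul_zero]
      · push_cast
        ring
    refine (mul_left_cancel₀ (mul_ne_zero (hsucc j) (hsub _ hi)) ?_).symm
    simp only [Nat.cast_add, Nat.cast_one, Nat.add_sub_cancel] at hline ⊢
    linear_combination hline - hprev

end Ladder

section Sites

variable {V : Type*} [DecidableEq V] {G : SimpleGraph V} [G.LocallyFinite] {S : Finset V}

theorem siteOp_mulVec (x : S)
    (M : Matrix (Fin (G.degree (x : V) + 1)) (Fin (G.degree (x : V) + 1)) ℂ)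
    (v : Config G S → ℂ) (k : Config G S) :
    (siteOp G x M).mulVec v k = M.mulVec (fun a => v (Function.update k x a)) (k x) := by
  rw [Matrix.mulVec, dotProduct, Matrix.mulVec, dotProduct]
  refine (Finset.sum_of_injOn (fun a => Function.update k x a)
    (Function.update_injective k x).injOn (by simp) ?_ ?_).symm
  · intro l _ hl
    rw [siteOp, Matrix.of_apply, if_neg, zero_mul]
    intro h
    exact hl ⟨l x, by simp, Function.update_eq_iff.mpr ⟨rfl, h⟩⟩
  · intro a _
    rw [siteOp, Matrix.of_apply, if_pos, Function.update_self]
    intro y hy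
    rw [Function.update_of_ne hy]

theorem siteOp_add (x : S)
    (M N : Matrix (Fin (G.degree (x : V) + 1)) (Fin (G.degree (x : V) + 1)) ℂ) :
    siteOp G x (M + N) = siteOp G x M + siteOp G x N := by
  ext k l
  simp only [siteOp, Matrix.of_apply, Matrix.add_apply]
  split_ifs <;> simp

theorem siteOp_smul (x : S) (c : ℂ)
    (M : Matrix (Fin (G.degree (x : V) + 1)) (Fin (G.degree (x : V) + 1)) ℂ) :
    siteOp G x (c • M) = c • siteOp G x M := by
  ext k l
  simp only [siteOp, Matrix.of_apply, Matrix.smul_apply]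
  split_ifs <;> simp

theorem siteOp_sub (x : S)
    (M N : Matrix (Fin (G.degree (x : V) + 1)) (Fin (G.degree (x : V) + 1)) ℂ) :
    siteOp G x (M - N) = siteOp G x M - siteOp G x N := by
  rw [sub_eq_add_neg, ← neg_one_smul ℂ N, siteOp_add, siteOp_smul, neg_one_smul, ← sub_eq_add_neg]

theorem siteOp_mul (x : S)
    (M N : Matrix (Fin (G.degree (x : V) + 1)) (Fin (G.degree (x : V) + 1)) ℂ) :
    siteOp G x (M * N) = siteOp G x M * siteOp G x N := by
  refine Matrix.ext_iff_mulVec.mpr fun v => funext fun k => ?_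
  simp only [← Matrix.mulVec_mulVec, siteOp_mulVec, Function.update_self, Function.update_idem]

theorem siteOp_mul_siteOp_mulVec {x y : S} (hxy : x ≠ y)
    (M : Matrix (Fin (G.degree (x : V) + 1)) (Fin (G.degree (x : V) + 1)) ℂ)
    (N : Matrix (Fin (G.degree (y : V) + 1)) (Fin (G.degree (y : V) + 1)) ℂ)
    (v : Config G S → ℂ) (k : Config G S) :
    (siteOp G x M * siteOp G y N).mulVec v k = M.mulVec (fun m => N.mulVec
      (fun n => v (Function.update (Function.update k x m) y n)) (k y)) (k x) := by
  simp only [← Matrix.mulVec_mulVec, siteOp_mulVec, Function.update_of_ne hxy.symm]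

theorem siteOp_commute {x y : S} (hxy : x ≠ y)
    (M : Matrix (Fin (G.degree (x : V) + 1)) (Fin (G.degree (x : V) + 1)) ℂ)
    (N : Matrix (Fin (G.degree (y : V) + 1)) (Fin (G.degree (y : V) + 1)) ℂ) :
    Commute (siteOp G x M) (siteOp G y N) := by
  refine Matrix.ext_iff_mulVec.mpr fun v => funext fun k => ?_
  rw [siteOp_mul_siteOp_mulVec hxy, siteOp_mul_siteOp_mulVec hxy.symm]
  simp only [Matrix.mulVec, dotProduct, Finset.mul_sum]
  rw [Finset.sum_comm]
  refine Finset.sum_congr rfl fun n _ => Finset.sum_congr rfl fun m _ => ?_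
  rw [Function.update_comm hxy, mul_left_comm]

theorem siteOp_diagonal_mulVec (x : S) (g : Fin (G.degree (x : V) + 1) → ℂ) (v : Config G S → ℂ)
    (k : Config G S) : (siteOp G x (Matrix.diagonal g)).mulVec v k = g (k x) * v k := by
  rw [siteOp_mulVec, Matrix.mulVec_diagonal, Function.update_eq_self]

theorem totalSpinSq_eq {x y : S} (hxy : x ≠ y) :
    totalSpinSq G x y =
      siteOp G x
          (Matrix.diagonal fun _ => (G.degree (x : V) : ℂ) / 2 * (G.degree (x : V) / 2 + 1)) +
        siteOp G y
          (Matrix.diagonal fun _ => (G.degree (y : V) : ℂ) / 2 * (G.degree (y : V) / 2 + 1)) +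
      (siteOp G x (spinPlus _) * siteOp G y (spinMinus _) +
        siteOp G x (spinMinus _) * siteOp G y (spinPlus _)) +
      (2 : ℂ) • (siteOp G x (spinZ _) * siteOp G y (spinZ _)) := by
  rw [totalSpinSq, spinX, spinX, spinY, spinY]
  simp only [← spin_casimir, siteOp_smul, siteOp_add, siteOp_sub, siteOp_mul]
  exact ladder_sum_sq (siteOp_commute hxy _ _) (siteOp_commute hxy _ _) (siteOp_commute hxy _ _)

/-- The vector `v` lies in the space on which the sites `x` and `y` have maximal total spin, the
range of `edgeProjection G x y`. -/
def HasMaximalSpin (x y : S) (v : Config G S → ℂ) : Prop :=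
  (totalSpinSq G x y).mulVec v = (maxSpin G x y * (maxSpin G x y + 1)) • v

theorem HasMaximalSpin.line_equation {x y : S} (hxy : x ≠ y) {v : Config G S → ℂ}
    (hv : HasMaximalSpin x y v) {k : Config G S} {f : ℕ → ℕ → ℂ}
    (hf : ∀ m n, v (Function.update (Function.update k x m) y n) =
      symNorm (G.degree (y : V)) n * (symNorm (G.degree (x : V)) m * f m n)) :
    ((k x : ℕ) * (G.degree (y : V) - (k y : ℕ)) + (k y : ℕ) * (G.degree (x : V) - (k x : ℕ))) *
        f (k x) (k y) =
      (k x : ℕ) * (G.degree (y : V) - (k y : ℕ)) * f (k x - 1) (k y + 1) +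
        (k y : ℕ) * (G.degree (x : V) - (k x : ℕ)) * f (k x + 1) (k y - 1) := by
  have hk : v k = symNorm (G.degree (y : V)) (k y) *
      (symNorm (G.degree (x : V)) (k x) * f (k x) (k y)) := by
    rw [← hf, Function.update_eq_self, Function.update_eq_self]
  have hne : symNorm (G.degree (x : V)) (k x) * symNorm (G.degree (y : V)) (k y) ≠ 0 :=
    mul_ne_zero (symNorm_ne_zero (k x).is_le) (symNorm_ne_zero (k y).is_le)
  have hspin := congrFun hv k
  simp only [totalSpinSq_eq hxy, Matrix.add_mulVec, Matrix.smul_mulVec, Pi.add_apply,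
    Pi.smul_apply, smul_eq_mul, siteOp_diagonal_mulVec, siteOp_mul_siteOp_mulVec hxy, hf,
    spinPlus_mulVec_spinMinus_mulVec, spinMinus_mulVec_spinPlus_mulVec, spinZ,
    Matrix.mulVec_diagonal, hk, maxSpin] at hspin
  exact mul_left_cancel₀ hne (by linear_combination -hspin)

end Sites

section ConfigNorm

variable {V : Type*} {G : SimpleGraph V} [G.LocallyFinite] {S : Finset V}

/-- The norm of the sum of the product states of spins 1/2 with `k x` ups at each vertex `x`, so
that `v k / configNorm k` is an unnormalised amplitude of `v`. -/
def configNorm (k : Config G S) : ℂ := ∏ z : S, symNorm (G.degree (z : V)) (k z)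

variable [DecidableEq V]

theorem configNorm_eq_mul {x y : S} (hxy : x ≠ y) (k : Config G S) :
    configNorm k = symNorm (G.degree (x : V)) (k x) * (symNorm (G.degree (y : V)) (k y) *
      ∏ z ∈ (Finset.univ.erase x).erase y, symNorm (G.degree (z : V)) (k z)) := by
  rw [configNorm, ← Finset.mul_prod_erase _ _ (Finset.mem_univ x), ← Finset.mul_prod_erase _ _
    (Finset.mem_erase.mpr ⟨hxy.symm, Finset.mem_univ y⟩)]

theorem HasMaximalSpin.div_configNorm_eq {x y : S} (hxy : x ≠ y) {v : Config G S → ℂ}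
    (hv : HasMaximalSpin x y v) {k l : Config G S} (hx : (k x : ℕ) = l x + 1)
    (hy : (l y : ℕ) = k y + 1) (hkl : ∀ z, z ≠ x → z ≠ y → k z = l z) :
    v k / configNorm k = v l / configNorm l := by
  let line (i j : ℕ) : Config G S :=
    Function.update (Function.update k x (Fin.ofNat _ i)) y (Fin.ofNat _ j)
  let f (i j : ℕ) : ℂ :=
    v (line i j) / (symNorm (G.degree (y : V)) j * symNorm (G.degree (x : V)) i)
  have hf {i j : ℕ} (m : Fin (G.degree (x : V) + 1)) (n : Fin (G.degree (y : V) + 1)) :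
      v (Function.update (Function.update (line i j) x m) y n) =
        symNorm (G.degree (y : V)) n * (symNorm (G.degree (x : V)) m * f m n) := by
    rw [← mul_assoc, mul_div_cancel₀ _ (mul_ne_zero (symNorm_ne_zero n.is_le)
      (symNorm_ne_zero m.is_le))]
    simp only [line, Fin.ofNat_val_eq_self, Function.update_comm hxy.symm, Function.update_idem]
  have hline := apply_succ_eq_of_line_equation (a := G.degree (x : V)) (b := G.degree (y : V))
    (f := f) fun i hi j hj => by
    have heq := hv.line_equation hxy (hf (i := i) (j := j))
    simpa only [line, Function.update_self, Function.update_of_ne hxy, Fin.val_ofNat,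
      Nat.mod_eq_of_lt (Nat.lt_succ_of_le hi), Nat.mod_eq_of_lt (Nat.lt_succ_of_le hj)] using heq
  have hk : line (l x + 1) (k y) = k := by
    simp only [line, ← hx, Fin.ofNat_val_eq_self, Function.update_eq_self]
  have hl : line (l x) (k y + 1) = l := by
    simp only [line, ← hy, Fin.ofNat_val_eq_self]
    refine Function.update_eq_iff.mpr ⟨rfl, fun z hzy => ?_⟩
    rcases eq_or_ne z x with rfl | hzx
    · rw [Function.update_self]
    · rw [Function.update_of_ne hzx, hkl z hzx hzy]
  have hstep := hline (l x) (by have := (k x).is_le; omega) (k y) (by have := (l y).is_le; omega)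
  have hrest : ∏ z ∈ (Finset.univ.erase x).erase y, symNorm (G.degree (z : V)) (k z) =
      ∏ z ∈ (Finset.univ.erase x).erase y, symNorm (G.degree (z : V)) (l z) := by
    refine Finset.prod_congr rfl fun z hz => ?_
    simp only [Finset.mem_erase, Finset.mem_univ, and_true] at hz
    rw [hkl z hz.2 hz.1]
  simp only [f, hk, hl] at hstep
  rw [configNorm_eq_mul hxy k, configNorm_eq_mul hxy l, hrest, hx, hy, ← mul_assoc, ← mul_assoc,
    mul_comm (symNorm _ (_ + 1)), mul_comm (symNorm _ (l x)), ← div_div, hstep, div_div]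

end ConfigNorm

/-! ### The Hamiltonian annihilates the valence bond solid -/

section Swap

variable {V : Type*} {G : SimpleGraph V} {T : Finset V} {x y : T}

theorem ne_of_adj_coe (h : G.Adj (x : V) (y : V)) : x ≠ y :=
  fun hxy => h.ne (congrArg Subtype.val hxy)

variable [DecidableEq V]

/-- Exchange the two spins 1/2 on the edge between `x` and `y`. -/
def swapLegs (h : G.Adj (x : V) (y : V)) (s : Legs G T) : Legs G T :=
  Function.update (Function.update s x (Function.update (s x) ⟨y, h⟩ (s y ⟨x, h.symm⟩))) y
    (Function.update (s y) ⟨x, h.symm⟩ (s x ⟨y, h⟩))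

variable (h : G.Adj (x : V) (y : V)) (s : Legs G T)

theorem swapLegs_fst : swapLegs h s x = Function.update (s x) ⟨y, h⟩ (s y ⟨x, h.symm⟩) := by
  rw [swapLegs, Function.update_of_ne (ne_of_adj_coe h), Function.update_self]

theorem swapLegs_snd : swapLegs h s y = Function.update (s y) ⟨x, h.symm⟩ (s x ⟨y, h⟩) := by
  rw [swapLegs, Function.update_self]

theorem swapLegs_of_ne {z : T} (hx : z ≠ x) (hy : z ≠ y) : swapLegs h s z = s z := by
  rw [swapLegs, Function.update_of_ne hy, Function.update_of_ne hx]

theorem swapLegs_involutive : Function.Involutive (swapLegs h) := by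
  intro s
  funext z
  rcases eq_or_ne z x with rfl | hx
  · rw [swapLegs_fst, swapLegs_fst, swapLegs_snd, Function.update_self, Function.update_idem,
      Function.update_eq_self]
  rcases eq_or_ne z y with rfl | hy
  · rw [swapLegs_snd, swapLegs_snd, swapLegs_fst, Function.update_self, Function.update_idem,
      Function.update_eq_self]
  · rw [swapLegs_of_ne _ _ hx hy, swapLegs_of_ne _ _ hx hy]

variable {s} in
theorem swapLegs_eq_self (hs : s x ⟨y, h⟩ = s y ⟨x, h.symm⟩) : swapLegs h s = s := by
  rw [swapLegs, ← hs, Function.update_eq_self, Function.update_eq_self, hs,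
    Function.update_eq_self, Function.update_eq_self]

theorem leg_swapLegs_fst : leg (swapLegs h s) x y = leg s y x := by
  rw [leg_of_mem _ x.2 h, leg_of_mem _ y.2 h.symm, swapLegs_fst, Function.update_self]

theorem leg_swapLegs_snd : leg (swapLegs h s) y x = leg s x y := by
  rw [leg_of_mem _ x.2 h, leg_of_mem _ y.2 h.symm, swapLegs_snd, Function.update_self]

theorem leg_swapLegs_of_ne {a b : V} (hxy : a ≠ x ∨ b ≠ y) (hyx : a ≠ y ∨ b ≠ x) :
    leg (swapLegs h s) a b = leg s a b := by
  by_cases hab : a ∈ T ∧ G.Adj a b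
  swap
  · rw [leg, dif_neg hab, leg, dif_neg hab]
  obtain ⟨ha, hadj⟩ := hab
  rw [leg_of_mem _ ha hadj, leg_of_mem _ ha hadj]
  rcases eq_or_ne (⟨a, ha⟩ : T) x with rfl | hax
  · rw [swapLegs_fst, Function.update_of_ne]
    exact fun hb => hxy.resolve_left (by simp) (congrArg Subtype.val hb)
  rcases eq_or_ne (⟨a, ha⟩ : T) y with rfl | hay
  · rw [swapLegs_snd, Function.update_of_ne]
    exact fun hb => hyx.resolve_left (by simp) (congrArg Subtype.val hb)
  · rw [swapLegs_of_ne h s hax hay]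

end Swap

section UpCount

variable {V : Type*} {G : SimpleGraph V} [G.LocallyFinite] {T : Finset V}

/-- The number of up spins at each vertex: the only basis vector of `⨂_{x ∈ T} ℂ^(deg x + 1)` that
overlaps with the product state labelled by `s`. -/
def upCount (s : Legs G T) : Config G T := fun z =>
  ⟨numUp (s z), Nat.lt_succ_of_le ((numUp_le_card _).trans_eq (G.card_neighborSet_eq_degree z))⟩

theorem legAmplitude_eq (k : Config G T) (s : Legs G T) :
    legAmplitude k s = if k = upCount s then 1 / configNorm k else 0 := by
  have hfactor (z : T) : symAmplitude (k z : ℕ) (s z) =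
      if k z = upCount s z then 1 / symNorm (G.degree (z : V)) (k z) else 0 := by
    rw [symAmplitude_eq_ite_numUp, G.card_neighborSet_eq_degree, symNorm, Complex.ofReal_div,
      Complex.ofReal_one]
    exact if_congr (by rw [Fin.ext_iff, eq_comm]; rfl) rfl rfl
  simp only [legAmplitude, hfactor, Finset.prod_ite_zero, Finset.mem_univ, forall_const,
    ← funext_iff, Finset.prod_div_distrib, Finset.prod_const_one, configNorm]

variable [DecidableEq V]

theorem sum_mul_legAmplitude (v : Config G T → ℂ) (s : Legs G T) :
    ∑ k, v k * legAmplitude k s = v (upCount s) / configNorm (upCount s) := by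
  simp only [legAmplitude_eq, mul_ite, mul_zero, Finset.sum_ite_eq', Finset.mem_univ, if_true,
    mul_one_div]

variable {x y : T} (h : G.Adj (x : V) (y : V)) {v : Config G T → ℂ}

theorem HasMaximalSpin.div_configNorm_swapLegs_of_up_down (hv : HasMaximalSpin x y v)
    {s : Legs G T} (hx : s x ⟨y, h⟩ = true) (hy : s y ⟨x, h.symm⟩ = false) :
    v (upCount s) / configNorm (upCount s) =
      v (upCount (swapLegs h s)) / configNorm (upCount (swapLegs h s)) := by
  refine hv.div_configNorm_eq (ne_of_adj_coe h) ?_ ?_ fun z hzx hzy => ?_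
  · change numUp (s x) = numUp (swapLegs h s x) + 1
    rw [swapLegs_fst, numUp_update, numUp_eq_toNat_add (s x) ⟨y, h⟩, hx, hy, Bool.toNat_true,
      Bool.toNat_false, zero_add, add_comm]
  · change numUp (swapLegs h s y) = numUp (s y) + 1
    rw [swapLegs_snd, numUp_update, numUp_eq_toNat_add (s y) ⟨x, h.symm⟩, hx, hy,
      Bool.toNat_true, Bool.toNat_false, zero_add, add_comm]
  · simp only [upCount, swapLegs_of_ne h s hzx hzy]

theorem HasMaximalSpin.div_configNorm_swapLegs (hv : HasMaximalSpin x y v) (s : Legs G T) :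
    v (upCount (swapLegs h s)) / configNorm (upCount (swapLegs h s)) =
      v (upCount s) / configNorm (upCount s) := by
  cases hx : s x ⟨y, h⟩ <;> cases hy : s y ⟨x, h.symm⟩
  · rw [swapLegs_eq_self h (hx.trans hy.symm)]
  · rw [hv.div_configNorm_swapLegs_of_up_down h (s := swapLegs h s)
      (by rw [swapLegs_fst, Function.update_self, hy])
      (by rw [swapLegs_snd, Function.update_self, hx]), swapLegs_involutive]
  · exact (hv.div_configNorm_swapLegs_of_up_down h hx hy).symm
  · rw [swapLegs_eq_self h (hx.trans hy.symm)]

end UpCount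

section Ground

variable {V : Type*} [DecidableEq V] {G : SimpleGraph V} [G.LocallyFinite] {o : V} {n : ℕ}
  {x y : ball G o n}

theorem singlet_swap (a b : Bool) : singlet b a = -singlet a b := by
  cases a <;> cases b <;> simp [singlet]

theorem singletProduct_swapLegs (hG : G.IsTree) (h : IsChild G o (x : V) (y : V))
    (s : Legs G (ball G o n)) : singletProduct G o (swapLegs h.1 s) = -singletProduct G o s := by
  rw [singletProduct, singletProduct, prod_children_eq_mul hG x.2 h,
    prod_children_eq_mul hG x.2 h, if_pos y.2, if_pos y.2, leg_swapLegs_fst, leg_swapLegs_snd,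
    singlet_swap, neg_mul]
  congr 2
  refine Finset.prod_congr rfl fun z _ => Finset.prod_congr rfl fun w hw => ?_
  obtain ⟨hwy, hzw⟩ := Finset.mem_erase.mp hw
  have hreverse : z ≠ y ∨ w ≠ x := by
    by_contra! hcon
    have hdist := (mem_children.mp hzw).2
    rw [hcon.1, hcon.2, h.2] at hdist
    omega
  rw [leg_swapLegs_of_ne _ _ (Or.inr hwy) hreverse,
    leg_swapLegs_of_ne _ _ hreverse.symm (Or.inl hwy)]

theorem boundaryLegs_swapLegs (h : G.Adj (x : V) (y : V)) (s : Legs G (ball G o n)) :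
    boundaryLegs (swapLegs h s) = boundaryLegs s := by
  funext v
  have hv : (v : V) ∉ ball G o n := (Finset.mem_sdiff.mp v.2).2
  exact leg_swapLegs_of_ne h s (Or.inr fun hvy => hv (hvy ▸ y.2))
    (Or.inr fun hvx => hv (hvx ▸ x.2))

/-- Exchanging the two spins of the edge `xy` changes the sign of its singlet but not the amplitude
of a vector of maximal total spin, so the overlap equals its own negative. -/
theorem HasMaximalSpin.sum_mul_vbs_eq_zero (hG : G.IsTree) (h : IsChild G o (x : V) (y : V))
    {v : Config G (ball G o n) → ℂ} (hv : HasMaximalSpin x y v) (b : BoundaryConfig G o n) :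
    ∑ k, v k * vbs G o n k b = 0 := by
  let overlap (s : Legs G (ball G o n)) : ℂ := v (upCount s) / configNorm (upCount s) *
    (singletProduct G o s * if b = boundaryLegs s then 1 else 0)
  have hsum : ∑ k, v k * vbs G o n k b = ∑ s, overlap s := by
    simp only [vbs_apply hG, Finset.mul_sum]
    rw [Finset.sum_comm]
    refine Finset.sum_congr rfl fun s _ => ?_
    simp only [overlap, ← sum_mul_legAmplitude, Finset.sum_mul, mul_assoc]
  have hswap (s : Legs G (ball G o n)) : overlap (swapLegs h.1 s) = -overlap s := by
    simp only [overlap, hv.div_configNorm_swapLegs, singletProduct_swapLegs hG h,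
      boundaryLegs_swapLegs, neg_mul, mul_neg]
  refine hsum.trans (self_eq_neg.mp ?_)
  calc ∑ s, overlap s = ∑ s, overlap (swapLegs h.1 s) :=
        (Equiv.sum_comp ((swapLegs_involutive h.1).toPerm _) overlap).symm
    _ = -∑ s, overlap s := by simp only [hswap, Finset.sum_neg_distrib]

theorem edgeProjection_vbs_mulVec (hG : G.IsTree) (h : IsChild G o (x : V) (y : V))
    (u : BoundaryConfig G o n → ℂ) :
    edgeProjection G x y (WithLp.toLp 2 ((vbs G o n).mulVec u)) = 0 := by
  rw [edgeProjection, ContinuousLinearMap.coe_coe, Submodule.starProjection_apply_eq_zero_iff,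
    Submodule.mem_orthogonal]
  intro v hv
  have hspin : HasMaximalSpin x y v.ofLp := by
    have heigen := congrArg WithLp.ofLp (Module.End.mem_eigenspace_iff.mp hv)
    rwa [Matrix.ofLp_toLpLin, Matrix.toLin'_apply, WithLp.ofLp_smul] at heigen
  have hoverlap : Matrix.vecMul (star v.ofLp) (vbs G o n) = 0 := by
    funext b
    have hstar := congrArg star (hspin.sum_mul_vbs_eq_zero hG h b)
    simp only [star_sum, star_mul', star_vbs hG, star_zero] at hstar
    exact hstar
  rw [EuclideanSpace.inner_eq_star_dotProduct, dotProduct_comm, Matrix.dotProduct_mulVec, hoverlap,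
    zero_dotProduct]

theorem hamiltonian_density_eq_zero (hG : G.IsTree) (n : ℕ) (B : BoundaryMatrix G o n) :
    hamiltonian G o n ∘ₗ Matrix.toEuclideanLin (density G o n B) = 0 := by
  refine LinearMap.ext fun u => ?_
  rw [LinearMap.comp_apply, LinearMap.zero_apply, Matrix.toLpLin_apply, density,
    Matrix.mul_assoc, ← Matrix.mulVec_mulVec, hamiltonian, LinearMap.sum_apply]
  refine Finset.sum_eq_zero fun x _ => ?_
  rw [LinearMap.sum_apply]
  refine Finset.sum_eq_zero fun y _ => ?_
  split_ifs with h
  · exact edgeProjection_vbs_mulVec hG h _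
  · rfl

end Ground

/-! ### The two ground states -/

section GroundStates

variable {V : Type*} {G : SimpleGraph V} [G.LocallyFinite] {o : V} {θ : ℕ → ℝ}

/-- The signs of the singlets alternate along the layers, so an orbit of the branching maps becomes
consistent after alternating the signs of the fields. -/
theorem isConsistent_alternating (hG : G.Connected) {d : ℕ → ℕ}
    (hd : ∀ x, G.degree x = d (G.dist o x)) {τ : ℕ → ℝ}
    (hτ : ∀ i, τ i = branchField (d (i + 1) - 1) (τ (i + 1))) :
    IsConsistent G o fun i => (-1) ^ i * τ (i - 1) := by
  intro v hv
  obtain ⟨i, hi⟩ := Nat.exists_eq_succ_of_ne_zero (hG.pos_dist_of_ne hv.symm).ne'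
  simp only [hd, hi, Nat.succ_eq_add_one, Nat.add_sub_cancel, branchField_neg_one_pow_mul, ← hτ]
  ring

variable [DecidableEq V]

theorem isGroundBoundary_productBoundary (hG : G.IsTree) (hθ : IsConsistent G o θ) (n : ℕ) :
    IsGroundBoundary G o n (productBoundary G o θ n) :=
  ⟨posSemidef_productBoundary θ n, trace_density_ne_zero hG hθ n,
    hamiltonian_density_eq_zero hG n _⟩

theorem expectation_eq_of_le (hG : G.IsTree) (hθ : IsConsistent G o θ) {m n : ℕ} (hmn : m ≤ n)
    {S : Finset V} (h : S ⊆ ball G o m) (A : Observable G S) :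
    expectation G o n (productBoundary G o θ n) S A =
      expectation G o m (productBoundary G o θ m) S A := by
  induction n, hmn using Nat.le_induction with
  | base => rfl
  | succ n hmn ih =>
    rw [expectation_succ hG hθ (h.trans (ball_mono hG.connected hmn)), ih]

theorem exists_isInfiniteVolumeGroundState (hG : G.IsTree) (hθ : IsConsistent G o θ) :
    ∃ ω : (S : Finset V) → Observable G S → ℂ, IsInfiniteVolumeGroundState G o ω ∧
      ∀ n A, ω (ball G o n) A = expectation G o n (productBoundary G o θ n) (ball G o n) A := by
  choose m hm using exists_subset_ball (o := o) hG.connected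
  refine ⟨fun S A => expectation G o (m S) (productBoundary G o θ (m S)) S A,
    ⟨productBoundary G o θ, isGroundBoundary_productBoundary hG hθ, fun S A => ?_⟩,
    fun n A => ?_⟩
  · refine tendsto_const_nhds.congr' ?_
    filter_upwards [eventually_ge_atTop (m S)] with n hn
    exact (expectation_eq_of_le hG hθ hn (hm S) A).symm
  · rcases le_total (m (ball G o n)) n with h | h
    · exact (expectation_eq_of_le hG hθ h (hm _) A).symm
    · exact expectation_eq_of_le hG hθ h subset_rfl A

variable (G o) in
/-- The projection onto the state of the root with all spins 1/2 up. -/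
def rootUp : Observable G (ball G o 0) :=
  Matrix.diagonal fun k => if (k ⟨o, root_mem_ball_zero⟩ : ℕ) = G.degree o then 1 else 0

theorem sum_config_ball_zero (φ : ℕ → ℂ) :
    ∑ k : Config G (ball G o 0), φ (k ⟨o, root_mem_ball_zero⟩) =
      ∑ j ∈ Finset.range (G.degree o + 1), φ j := by
  let : Unique (ball G o 0) := uniqueBallZero
  rw [← Fin.sum_univ_eq_sum_range]
  exact Fintype.sum_equiv (Equiv.piUnique fun x : ball G o 0 => Fin (G.degree (x : V) + 1)) _
    (fun j : Fin (G.degree o + 1) => φ j) fun k => rfl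

theorem expectation_rootUp (hG : G.IsTree) (θ : ℕ → ℝ) :
    expectation G o 0 (productBoundary G o θ 0) (ball G o 0) (rootUp G o) =
      ((Real.exp (G.degree o * θ 1) / partitionSum (G.degree o) (θ 1) : ℝ) : ℂ) := by
  rw [expectation, dif_pos subset_rfl, extend_self, density_productBoundary hG]
  simp only [Matrix.trace, Matrix.diag_apply, rootUp, Matrix.mul_diagonal, netState_root_diag]
  rw [sum_config_ball_zero fun j => ((Real.exp ((2 * j - G.degree o) * θ 1) : ℝ) : ℂ) *
      (if j = G.degree o then 1 else 0),
    sum_config_ball_zero fun j => ((Real.exp ((2 * j - G.degree o) * θ 1) : ℝ) : ℂ)]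
  simp only [mul_ite, mul_one, mul_zero]
  rw [Finset.sum_ite_eq' (Finset.range (G.degree o + 1)), if_pos (Finset.self_mem_range_succ _),
    partitionSum, two_mul, add_sub_cancel_right]
  push_cast
  rfl

theorem exists_ne_isInfiniteVolumeGroundState (hG : G.IsTree) (ho : 0 < G.degree o)
    (hθ : IsConsistent G o θ) (hθ1 : θ 1 ≠ 0) :
    ∃ ω₁ ω₂ : (S : Finset V) → Observable G S → ℂ,
      IsInfiniteVolumeGroundState G o ω₁ ∧ IsInfiniteVolumeGroundState G o ω₂ ∧ ω₁ ≠ ω₂ := by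
  obtain ⟨ω₁, h₁, hω₁⟩ := exists_isInfiniteVolumeGroundState hG hθ
  obtain ⟨ω₂, h₂, hω₂⟩ := exists_isInfiniteVolumeGroundState hG hθ.neg
  refine ⟨ω₁, ω₂, h₁, h₂, ?_⟩
  rintro rfl
  have h := (hω₁ 0 (rootUp G o)).symm.trans (hω₂ 0 (rootUp G o))
  rw [expectation_rootUp hG, expectation_rootUp hG, Complex.ofReal_inj, Pi.neg_apply,
    partitionSum_neg, div_left_inj' (partitionSum_pos _ _).ne', Real.exp_eq_exp] at h
  exact hθ1 (self_eq_neg.mp (mul_left_cancel₀ (Nat.cast_ne_zero.mpr ho.ne') h))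

end GroundStates

theorem sum_Icc_log_sub_one_div {d : ℕ → ℕ} (hd : ∀ i, 1 ≤ d (i + 1)) (c : ℝ) (n : ℕ) :
    ∑ i ∈ Finset.Icc 1 n, Real.log (((d i : ℝ) - 1) / c) =
      ∑ i ∈ Finset.range n, Real.log ((d (i + 1) - 1 : ℕ) / c) := by
  rw [← Finset.Ico_add_one_right_eq_Icc, Finset.sum_Ico_eq_sum_range, Nat.add_sub_cancel]
  refine Finset.sum_congr rfl fun i _ => ?_
  rw [add_comm 1, Nat.cast_sub (hd i), Nat.cast_one]

end AKLT

end

theorem mainTheorem4_general {V : Type*} [DecidableEq V] [Infinite V]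
    (G : SimpleGraph V) [G.LocallyFinite] (hG : G.IsTree) (o : V) (d : ℕ → ℕ)
    (hd : ∀ x : V, G.degree x = d (G.dist o x))
    (hlim : 0 < liminf
      (fun n : ℕ =>
        (((1 / (n : ℝ)) * ∑ i ∈ Finset.Icc 1 n, Real.log (((d i : ℝ) - 1) / 3) : ℝ) : EReal))
      atTop) :
    ∃ ω₁ ω₂ : (S : Finset V) → AKLT.Observable G S → ℂ,
      AKLT.IsInfiniteVolumeGroundState G o ω₁ ∧
      AKLT.IsInfiniteVolumeGroundState G o ω₂ ∧ ω₁ ≠ ω₂ := by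
  have htwo (i : ℕ) : 2 ≤ d (i + 1) := by
    obtain ⟨x, hx, hdeg⟩ := AKLT.exists_dist_eq_and_two_le_degree hG.connected o i
    rwa [hd, hx] at hdeg
  have hroot : 0 < G.degree o := hG.connected.preconnected.degree_pos_of_nontrivial o
  simp only [AKLT.sum_Icc_log_sub_one_div fun i => one_le_two.trans (htwo i)] at hlim
  obtain ⟨τ, hτ_pos, hτ⟩ :=
    AKLT.exists_branchField_orbit (fun i => Nat.sub_pos_of_lt (htwo i)) hlim
  exact AKLT.exists_ne_isInfiniteVolumeGroundState hG hroot
    (AKLT.isConsistent_alternating hG.connected hd hτ) (by simpa using hτ_pos.ne')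

theorem mainTheorem4 {V : Type*} [DecidableEq V] [Infinite V]
    (G : SimpleGraph V) [G.LocallyFinite] (hG : G.IsTree) (o : V) (d : ℕ → ℕ)
    (hd : ∀ x : V, G.degree x = d (G.dist o x))
    (L : EReal) (hL : 0 < L)
    (hlim : Tendsto
      (fun n : ℕ =>
        (((1 / (n : ℝ)) * ∑ i ∈ Finset.Icc 1 n, Real.log (((d i : ℝ) - 1) / 3) : ℝ) : EReal))
      atTop (𝓝 L)) :
    ∃ ω₁ ω₂ : (S : Finset V) → AKLT.Observable G S → ℂ,
      AKLT.IsInfiniteVolumeGroundState G o ω₁ ∧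
      AKLT.IsInfiniteVolumeGroundState G o ω₂ ∧ ω₁ ≠ ω₂ :=
  mainTheorem4_general G hG o d hd (by rwa [hlim.liminf_eq])
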